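/- **Setting.** For $m\ge 2$ and $h\ge 1$ let $\mathcal H_m^{\otimes h}$ be the real vector space of Hermitian operators on $(\mathbb C^m)^{\otimes h}$. For an $N\times N$ matrix $A$ put $|||A|||_2=\big(\tfrac1N\operatorname{Tr}A^\dagger A\big)^{1/2}$. An $m$-dimensional noisy maximally entangled state (noisy MES) is a density operator $\psi_{AB}$ on $\mathbb C^m\otimes\mathbb C^m$ with $\psi_A=\psi_B=\mathbb 1_m/m$ and maximal correlation $$\rho(\psi_{AB})=\sup\big\{|\operatorname{Tr}((X^\dagger\otimes Y)\psi_{AB})| : X,Y\in\mathbb C^{m\times m},\ \operatorname{Tr}X=\operatorname{Tr}Y=0,\ |||X|||_2=|||Y|||_2=1\big\}<1 .$$ Let $\gamma_n$ and $\gamma_{n\times k}$ be the standard Gaussian measures on $\mathbb R^n$ and $\mathbb R^{n\times k}$, and let $\mathcal G_\rho$ be the centred Gaussian law on $\mathbb R^2$ with covariance $\begin{pmatrix}1&\rho\\ \rho&1\end{pmatrix}$. Let $L^2(\mathcal H_m^{\otimes h},\gamma_n)$ be the space of square-integrable random operators $\mathbb R^n\to\mathcal H_m^{\otimes h}$. Let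 $\zeta(x)=x^2$ for $x\le 0$ and $\zeta(x)=0$ for $x>0$, acting on Hermitian matrices through the spectral decomposition. A multilinear random matrix of degree at most $d$ is $P(z)=\sum_{S\subseteq[n]}\big(\prod_{i\in S}z_i\big)P_S$ with $P_S\in\mathcal H_m^{\otimes h}$ and $P_S=0$ for $|S|>d$. For $M\in\mathbb R^{n\times n_0}$ and $x\in\mathbb R^{n_0}$, $x\neq0$, put $\tilde x=x/\|x\|_2$, so that $P(M\tilde x)=\sum_{S}\prod_{i\in S}\langle m_i,\tilde x\rangle\,P_S$ where $m_i$ is the $i$-th row of $M$. **Lemma.** There is a universal constant $C\in\mathbb Z_{>0}$ such that the following holds for all $d\in\mathbb Z_{>0}$ and $\delta>0$, with $n_0=\lceil C\,d^{Cd}/\delta^6\rceil$. For all $m\ge2$ and $h,n\ge1$ there are maps $f_M,g_M:L^2(\mathcal H_m^{\otimes h},\gamma_n)\to L^2(\mathcal H_m^{\otimes h},\gamma_{n_0})$, $M\in\mathbb R^{n\times n_0}$, which satisfy $f_M(P(\mathbf g))=P(M\tilde{\mathbf x})$ and $g_M(Q(\mathbf h))=Q(M\tilde{\mathbf y})$ for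 all $M$ and all multilinear random matrices $P,Q$ of degree at most $d$, and are linear and unital for every $M\neq 0$. Moreover, for every $m$-dimensional noisy MES $\psi_{AB}$ with $\rho=\rho(\psi_{AB})$, and all multilinear random matrices $P,Q$ of degree at most $d$ with $\mathbb E_{\mathbf g\sim\gamma_n}|||P(\mathbf g)|||_2^2\le1$ and $\mathbb E_{\mathbf h\sim\gamma_n}|||Q(\mathbf h)|||_2^2\le1$, if $\mathbf M\sim\gamma_{n\times n_0}$ then: 1. With probability at least $1-2\delta$ over $\mathbf M$, both $\mathbb E_{\mathbf x\sim\gamma_{n_0}}|||P(\mathbf M\tilde{\mathbf x})|||_2^2\le1+\delta$ and $\mathbb E_{\mathbf y\sim\gamma_{n_0}}|||Q(\mathbf M\tilde{\mathbf y})|||_2^2\le1+\delta$. 2. With probability at least $1-\delta$ over $\mathbf M$, $$\Big|\mathbb E_{(\mathbf x,\mathbf y)\sim\mathcal G_\rho^{\otimes n_0}}\operatorname{Tr}\big((P(\mathbf M\tilde{\mathbf x})\otimes Q(\mathbf M\tilde{\mathbf y}))\psi_{AB}^{\otimes h}\big)-\mathbb E_{(\mathbf g,\mathbf h)\sim\mathcal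 G_\rho^{\otimes n}}\operatorname{Tr}\big((P(\mathbf g)\otimes Q(\mathbf h))\psi_{AB}^{\otimes h}\big)\Big|\le\delta .$$ 3. $\mathbb E_{\mathbf g}\operatorname{Tr}\zeta(P(\mathbf g))=\mathbb E_{\mathbf M,\mathbf x}\operatorname{Tr}\zeta(P(\mathbf M\tilde{\mathbf x}))$ and $\mathbb E_{\mathbf h}\operatorname{Tr}\zeta(Q(\mathbf h))=\mathbb E_{\mathbf M,\mathbf y}\operatorname{Tr}\zeta(Q(\mathbf M\tilde{\mathbf y}))$, where $\mathbf g,\mathbf h\sim\gamma_n$, $\mathbf x,\mathbf y\sim\gamma_{n_0}$, and $\mathbf M\sim\gamma_{n\times n_0}$ is independent of $\mathbf x$ and of $\mathbf y$. -/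

import Mathlib

open MeasureTheory ProbabilityTheory
open scoped ENNReal ComplexOrder Matrix Kronecker

noncomputable section

namespace GaussDimRed

/-- Normalized 2-norm of an `N × N` complex matrix, `((1/N) Tr (Aᴴ A))^(1/2)`. -/
def nnorm2 {ι : Type} [Fintype ι] (A : Matrix ι ι ℂ) : ℝ :=
  Real.sqrt ((1 / (Fintype.card ι : ℝ)) * (Aᴴ * A).trace.re)

/-- Partial trace over the second tensor factor. -/
def partialTraceB {m : ℕ} (ψ : Matrix (Fin m × Fin m) (Fin m × Fin m) ℂ) :
    Matrix (Fin m) (Fin m) ℂ :=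
  fun a a' => ∑ b, ψ (a, b) (a', b)

/-- Partial trace over the first tensor factor. -/
def partialTraceA {m : ℕ} (ψ : Matrix (Fin m × Fin m) (Fin m × Fin m) ℂ) :
    Matrix (Fin m) (Fin m) ℂ :=
  fun b b' => ∑ a, ψ (a, b) (a, b')

/-- Quantum maximal correlation of a bipartite state. -/
def maximalCorrelation {m : ℕ} (ψ : Matrix (Fin m × Fin m) (Fin m × Fin m) ℂ) : ℝ :=
  sSup {r : ℝ | ∃ P Q : Matrix (Fin m) (Fin m) ℂ, P.trace = 0 ∧ Q.trace = 0 ∧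
    nnorm2 P = 1 ∧ nnorm2 Q = 1 ∧ r = ‖((Pᴴ ⊗ₖ Q) * ψ).trace‖}

/-- `m`-dimensional noisy maximally entangled state: a density operator whose two marginals are
maximally mixed and whose maximal correlation is less than one. -/
structure IsNoisyMES {m : ℕ} (ψ : Matrix (Fin m × Fin m) (Fin m × Fin m) ℂ) : Prop where
  posSemidef : ψ.PosSemidef
  trace_eq_one : ψ.trace = 1
  marginalA : partialTraceB ψ = ((1 / (m : ℂ)) • (1 : Matrix (Fin m) (Fin m) ℂ))
  marginalB : partialTraceA ψ = ((1 / (m : ℂ)) • (1 : Matrix (Fin m) (Fin m) ℂ))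
  maximalCorrelation_lt_one : maximalCorrelation ψ < 1

/-- Index set of the computational basis of `h` registers of dimension `m`. -/
abbrev Reg (m h : ℕ) : Type := Fin h → Fin m

/-- The real vector space of Hermitian operators on `h` registers of dimension `m`
(it equals the real tensor power `H_m^{⊗h}`). -/
def Herm (m h : ℕ) : Type := selfAdjoint.submodule ℝ (Matrix (Reg m h) (Reg m h) ℂ)

namespace Herm

variable {m h : ℕ}

instance : AddCommGroup (Herm m h) :=
  inferInstanceAs (AddCommGroup (selfAdjoint.submodule ℝ (Matrix (Reg m h) (Reg m h) ℂ)))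

instance : Module ℝ (Herm m h) :=
  inferInstanceAs (Module ℝ (selfAdjoint.submodule ℝ (Matrix (Reg m h) (Reg m h) ℂ)))

/-- The underlying matrix. -/
def mat : Herm m h →ₗ[ℝ] Matrix (Reg m h) (Reg m h) ℂ :=
  (selfAdjoint.submodule ℝ (Matrix (Reg m h) (Reg m h) ℂ)).subtype

/-- The identity operator. -/
def id (m h : ℕ) : Herm m h := ⟨1, IsSelfAdjoint.one _⟩

theorem isHermitian (P : Herm m h) : (mat P).IsHermitian := P.2

theorem mat_injective : Function.Injective (mat : Herm m h → Matrix (Reg m h) (Reg m h) ℂ) :=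
  Subtype.val_injective

theorem mat_id : mat (id m h) = 1 := rfl

/-- The inner product `⟨P, Q⟩ = (1/m^h) Tr (Pᴴ Q)`. -/
@[reducible] def core : InnerProductSpace.Core ℝ (Herm m h) where
  inner P Q := (1 / (Fintype.card (Reg m h) : ℝ)) * ((mat P)ᴴ * mat Q).trace.re
  conj_inner_symm P Q := by
    have : ((mat Q)ᴴ * mat P).trace = star (((mat P)ᴴ * mat Q).trace) := by
      rw [← Matrix.trace_conjTranspose, Matrix.conjTranspose_mul, Matrix.conjTranspose_conjTranspose]
    simp [this]
  re_inner_nonneg P := by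
    have h1 := (Matrix.posSemidef_conjTranspose_mul_self (mat P)).trace_nonneg
    exact mul_nonneg (by positivity) (Complex.le_def.1 h1).1
  add_left P Q R := by
    simp [Matrix.add_mul, mul_add]
  smul_left P Q r := by
    simp [mul_left_comm]
  definite P hP := by
    have h1 := (Matrix.posSemidef_conjTranspose_mul_self (mat P)).trace_nonneg
    apply mat_injective
    rw [map_zero]
    rcases isEmpty_or_nonempty (Reg m h) with hE | hE
    · exact Subsingleton.elim _ _
    · have hN : (1 / (Fintype.card (Reg m h) : ℝ)) ≠ 0 :=
        one_div_ne_zero (Nat.cast_ne_zero.2 Fintype.card_ne_zero)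
      have h2 : ((mat P)ᴴ * mat P).trace.re = 0 := (mul_eq_zero.1 hP).resolve_left hN
      have h3 := (Complex.le_def.1 h1).2
      exact Matrix.trace_conjTranspose_mul_self_eq_zero_iff.1 (Complex.ext h2 h3.symm)

instance : NormedAddCommGroup (Herm m h) :=
  @InnerProductSpace.Core.toNormedAddCommGroup ℝ (Herm m h) _ _ _ core

instance : InnerProductSpace ℝ (Herm m h) := InnerProductSpace.ofCore core.toCore

theorem norm_eq_nnorm2 (P : Herm m h) : ‖P‖ = nnorm2 (mat P) := rfl

end Herm

open Herm (mat)

/-- `ψ^{⊗h}`, with the `h` registers of the first party grouped together, followed by the `h`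
registers of the second party. -/
def tensorPower {m : ℕ} (ψ : Matrix (Fin m × Fin m) (Fin m × Fin m) ℂ) (h : ℕ) :
    Matrix (Reg m h × Reg m h) (Reg m h × Reg m h) ℂ :=
  fun p q => ∏ i, ψ (p.1 i, p.2 i) (q.1 i, q.2 i)

/-- `Tr ((P ⊗ Q) ψ^{⊗h})`. -/
def corr {m h : ℕ} (ψ : Matrix (Fin m × Fin m) (Fin m × Fin m) ℂ) (P Q : Herm m h) : ℂ :=
  ((mat P ⊗ₖ mat Q) * tensorPower ψ h).trace

/-- `ζ x = x²` for `x ≤ 0` and `ζ x = 0` otherwise. -/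
def zeta (x : ℝ) : ℝ := if x ≤ 0 then x ^ 2 else 0

/-- `Tr ζ(P)`, where `ζ` acts on the Hermitian matrix `P` through its spectral decomposition. -/
def traceZeta {m h : ℕ} (P : Herm m h) : ℝ :=
  (P.isHermitian.cfc zeta).trace.re

/-- The standard Gaussian measure `γ_n` on `ℝⁿ`. -/
abbrev gauss (n : ℕ) : Measure (EuclideanSpace ℝ (Fin n)) :=
  stdGaussian (EuclideanSpace ℝ (Fin n))

/-- The law `γ_{n × k}` of an `n × k` matrix with independent standard Gaussian entries. -/
def gaussMatrix (n k : ℕ) : Measure (Fin n → Fin k → ℝ) :=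
  Measure.pi fun _ => Measure.pi fun _ => gaussianReal 0 1

/-- The law `G_ρ^{⊗n}` of `n` independent pairs of `ρ`-correlated standard Gaussians. -/
def corrGauss (ρ : ℝ) (n : ℕ) : Measure (Fin n → EuclideanSpace ℝ (Fin 2)) :=
  Measure.pi fun _ => multivariateGaussian 0 !![1, ρ; ρ, 1]

/-- The vector of the first (`k = 0`) or second (`k = 1`) coordinates of `n` pairs. -/
def coords {n : ℕ} (k : Fin 2) (p : Fin n → EuclideanSpace ℝ (Fin 2)) :
    EuclideanSpace ℝ (Fin n) :=
  WithLp.toLp 2 fun i => p i k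

/-- The multilinear matrix polynomial `P(z) = ∑_{S ⊆ [n]} (∏_{i ∈ S} z_i) P_S`. -/
def evalPoly {m h n : ℕ} (P : Finset (Fin n) → Herm m h) (z : EuclideanSpace ℝ (Fin n)) :
    Herm m h :=
  ∑ S, (∏ i ∈ S, z i) • P S

/-- The multilinear matrix polynomial with coefficients `P_S` has degree at most `d`. -/
def DegreeLE {m h n : ℕ} (P : Finset (Fin n) → Herm m h) (d : ℕ) : Prop :=
  ∀ S, d < S.card → P S = 0

/-- `M x̃` with `x̃ = x / ‖x‖₂`: the `i`-th coordinate is the inner product of the `i`-th row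
of `M` with `x̃`. -/
def proj {n k : ℕ} (M : Matrix (Fin n) (Fin k) ℝ) (x : EuclideanSpace ℝ (Fin k)) :
    EuclideanSpace ℝ (Fin n) :=
  WithLp.toLp 2 (M *ᵥ WithLp.ofLp (‖x‖⁻¹ • x))

/-- The space `L²(H_m^{⊗h}, γ_n)` of square-integrable random Hermitian matrices. -/
abbrev L2Herm (m h n : ℕ) : Type := Lp (Herm m h) 2 (gauss n)

theorem memLp_coord {n : ℕ} (i : Fin n) (p : ℝ≥0∞) (hp : p ≠ ∞) :
    MemLp (fun z : EuclideanSpace ℝ (Fin n) => z i) p (gauss n) :=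
  IsGaussian.memLp_dual (gauss n) (EuclideanSpace.proj i : EuclideanSpace ℝ (Fin n) →L[ℝ] ℝ) p hp

theorem memLp_monomial {n : ℕ} (S : Finset (Fin n)) :
    MemLp (fun z : EuclideanSpace ℝ (Fin n) => ∏ i ∈ S, z i) 2 (gauss n) := by
  have h1 := MemLp.prod' (s := S) (μ := gauss n)
    (f := fun i (z : EuclideanSpace ℝ (Fin n)) => z i)
    (p := fun _ => 2 * ((S.card : ℝ≥0∞) + 1))
    (fun i _ => memLp_coord i _ (ENNReal.mul_ne_top (by simp) (by simp)))
  refine h1.mono_exponent ?_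
  rw [ENNReal.le_inv_iff_le_inv, Finset.sum_const, nsmul_eq_mul]
  rw [ENNReal.mul_inv (by simp) (by simp), mul_left_comm]
  refine mul_le_of_le_one_right (by simp) ?_
  rw [← div_eq_mul_inv]
  exact ENNReal.div_le_of_le_mul (by simp)

theorem memLp_smul_const {n : ℕ} {E : Type} [NormedAddCommGroup E] [NormedSpace ℝ E]
    {f : EuclideanSpace ℝ (Fin n) → ℝ} (hf : MemLp f 2 (gauss n)) (c : E) :
    MemLp (fun z => f z • c) 2 (gauss n) :=
  (ContinuousLinearMap.toSpanSingleton ℝ c).comp_memLp' hf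

theorem memLp_evalPoly {m h n : ℕ} (P : Finset (Fin n) → Herm m h) :
    MemLp (evalPoly P) 2 (gauss n) :=
  memLp_finsetSum Finset.univ fun S _ => memLp_smul_const (memLp_monomial S) (P S)

/-- The random matrix `P(g)`, `g ∼ γ_n`, as an element of `L²(H_m^{⊗h}, γ_n)`. -/
def toL2 {m h n : ℕ} (P : Finset (Fin n) → Herm m h) : L2Herm m h n :=
  (memLp_evalPoly P).toLp (evalPoly P)

/-- The constant random matrix equal to the identity. -/
def idL2 (m h n : ℕ) : L2Herm m h n := Lp.const 2 (gauss n) (Herm.id m h)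

end GaussDimRed

end

/-! For a unit vector `u` and a Gaussian matrix `M`, the vector `M u` is exactly standard Gaussian.
Hence `(M, x) ↦ M x̃` preserves the Gaussian law, and the `ζ` identities are changes of variables
(`measurePreserving_proj`).

The two probabilistic claims are one concentration statement. Given a law `μ` of pairs `(u, v)` of
unit vectors and a bilinear form `B` with `|B x y| ≤ ‖x‖ ‖y‖`, let `G(M)` be the `μ`-average of
`B(P(Mu), Q(Mv))`. For second moments `u = v` and `B` is the inner product. For correlations `u, v`
are normalized `ρ`-correlated Gaussians and `B` is the correlation against `ψ^{⊗h}`, whose bound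
follows from the maximally mixed marginals (`norm_corr_le`).

Variance: rotating `(M, M')` through a quarter turn connects `G(M)` to `G(M')` and preserves the
joint law, so the second moment of `G(M') - G(M)` is at most `(π/2)²` times that of the derivative
of `G` at `M` in the direction `M'` (`lintegral_pairAvg_sub_sq_le`). That derivative is linear in
`M'`; since `u` and `v` have covariance `1/k`, Bessel's inequality makes its second moment `O(1/k)`
times averages of squared pairings (`lintegral_pairDerivAvg_sq_le`). These are controlled by the
hypercontractive fourth-moment bound `integral_norm_mlin_pow_four_le`, at a cost exponential in `d`.
Chebyshev's inequality concludes (`measure_pairAvg_deviation_le`).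

Mean: orthogonality of multilinear monomials turns the expectation over `M` into `∑_S E⟨u, v⟩^|S|
B(P_S, Q_S)` (`integral_pairAvg`). If `u = v` this is exactly the original second moment. Otherwise
`⟨u, v⟩` is within `O(1/√k)` of `ρ` on average, giving a bias `O(d/√k)`.

The maps on `L²` read off the multilinear Hermite coefficients and substitute `M x̃` (`reduce`). -/

open MeasureTheory ProbabilityTheory
open scoped ENNReal ComplexOrder Matrix Kronecker

noncomputable section

namespace GaussDimRed

/-! ### Multilinear polynomials and their derivatives -/

section Multilinear

variable {ι E : Type*} [AddCommGroup E] [Module ℝ E]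

/-- The multilinear polynomial `∑_{S ⊆ A} (∏_{i ∈ S} z_i) c_S`. -/
def mlin (A : Finset ι) (c : Finset ι → E) (z : ι → ℝ) : E :=
  ∑ S ∈ A.powerset, (∏ i ∈ S, z i) • c S

/-- The coefficients of the `i`-th partial derivative of a multilinear polynomial. -/
def partialCoeff [DecidableEq ι] (i : ι) (c : Finset ι → E) (S : Finset ι) : E :=
  if i ∈ S then 0 else c (insert i S)

/-- Affineness in each variable separately; this drives the induction for the fourth moment. -/
theorem mlin_insert [DecidableEq ι] {a : ι} {A : Finset ι} (ha : a ∉ A) (c : Finset ι → E)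
    (z : ι → ℝ) :
    mlin (insert a A) c z = mlin A c z + z a • mlin A (fun S => c (insert a S)) z := by
  unfold mlin
  rw [Finset.sum_powerset_insert ha, Finset.smul_sum]
  congr 1
  refine Finset.sum_congr rfl fun S hS => ?_
  rw [Finset.prod_insert fun h => ha (Finset.mem_powerset.1 hS h), mul_smul]

theorem mlin_congr {A : Finset ι} (c : Finset ι → E) {z w : ι → ℝ} (h : ∀ i ∈ A, z i = w i) :
    mlin A c z = mlin A c w := by
  refine Finset.sum_congr rfl fun S hS => ?_
  rw [Finset.prod_congr rfl fun i hi => h i (Finset.mem_powerset.1 hS hi)]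

theorem sum_filter_mem_eq [Fintype ι] [DecidableEq ι] {M : Type*} [AddCommMonoid M] (i : ι)
    (f : Finset ι → M) :
    ∑ S with i ∈ S, f S = ∑ S with i ∉ S, f (insert i S) := by
  refine Finset.sum_nbij' (fun S => S.erase i) (fun S => insert i S) ?_ ?_ ?_ ?_ ?_
  · simp
  · simp
  · intro S hS
    exact Finset.insert_erase (by simpa using hS)
  · intro S hS
    exact Finset.erase_insert (by simpa using hS)
  · intro S hS
    rw [Finset.insert_erase (by simpa using hS)]

theorem mlin_partialCoeff [Fintype ι] [DecidableEq ι] (i : ι) (c : Finset ι → E) (z : ι → ℝ) :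
    mlin Finset.univ (partialCoeff i c) z = ∑ S with i ∈ S, (∏ j ∈ S.erase i, z j) • c S := by
  rw [sum_filter_mem_eq]
  unfold mlin partialCoeff
  rw [Finset.sum_filter]
  simp only [Finset.powerset_univ]
  refine Finset.sum_congr rfl fun S _ => ?_
  by_cases h : i ∈ S <;> simp [h]

theorem hasDerivAt_mlin {E : Type*} [NormedAddCommGroup E] [NormedSpace ℝ E] [Fintype ι]
    [DecidableEq ι] (c : Finset ι → E) {z : ℝ → ι → ℝ} {w : ι → ℝ} {t : ℝ}
    (hz : ∀ i, HasDerivAt (fun s => z s i) (w i) t) :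
    HasDerivAt (fun s => mlin Finset.univ c (z s))
      (∑ i, w i • mlin Finset.univ (partialCoeff i c) (z t)) t := by
  have h : HasDerivAt (fun s => mlin Finset.univ c (z s))
      (∑ S ∈ Finset.univ.powerset, (∑ i ∈ S, (∏ j ∈ S.erase i, z t j) • w i) • c S) t :=
    HasDerivAt.fun_sum fun S _ => (HasDerivAt.fun_finsetProd fun i _ => hz i).smul_const (c S)
  convert h using 1
  simp_rw [mlin_partialCoeff, Finset.smul_sum, Finset.sum_smul, Finset.powerset_univ,
    Finset.sum_filter]
  rw [Finset.sum_comm]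
  refine Finset.sum_congr rfl fun S _ => ?_
  rw [← Finset.sum_filter]
  refine Finset.sum_congr (by ext; simp) fun i _ => ?_
  rw [smul_smul, smul_eq_mul, mul_comm]

end Multilinear

/-! ### Weighted coefficient norms -/

section Weights

variable {ι E : Type*} [NormedAddCommGroup E]

/-- The squared coefficient norms of a multilinear polynomial, weighted by `3 ^ |S|`. -/
def weight (A : Finset ι) (c : Finset ι → E) : ℝ :=
  ∑ S ∈ A.powerset, 3 ^ S.card * ‖c S‖ ^ 2

theorem weight_nonneg (A : Finset ι) (c : Finset ι → E) : 0 ≤ weight A c :=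
  Finset.sum_nonneg fun _ _ => by positivity

theorem weight_insert [DecidableEq ι] {a : ι} {A : Finset ι} (ha : a ∉ A) (c : Finset ι → E) :
    weight (insert a A) c = weight A c + 3 * weight A (fun S => c (insert a S)) := by
  unfold weight
  rw [Finset.sum_powerset_insert ha, Finset.mul_sum]
  congr 1
  refine Finset.sum_congr rfl fun S hS => ?_
  rw [Finset.card_insert_of_notMem fun h => ha (Finset.mem_powerset.1 hS h)]
  ring

theorem weight_le [Fintype ι] {d : ℕ} (c : Finset ι → E) (hc : ∀ S, d < S.card → c S = 0) :
    weight Finset.univ c ≤ 3 ^ d * ∑ S, ‖c S‖ ^ 2 := by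
  unfold weight
  rw [Finset.mul_sum, Finset.powerset_univ]
  refine Finset.sum_le_sum fun S _ => ?_
  rcases lt_or_ge d S.card with h | h
  · simp [hc S h]
  · gcongr
    norm_num

/-- A coefficient `c S` survives in exactly `|S|` of the partial derivatives, each time at level
`|S| - 1`; this is a total-influence bound. -/
theorem sum_weight_partialCoeff_le [Fintype ι] [DecidableEq ι] {d : ℕ} [Module ℝ E]
    (c : Finset ι → E)
    (hc : ∀ S, d < S.card → c S = 0) :
    ∑ i, weight Finset.univ (partialCoeff i c) ≤ d * 3 ^ d * ∑ S, ‖c S‖ ^ 2 := by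
  have h1 : ∀ i, weight Finset.univ (partialCoeff i c)
      = ∑ S, if i ∈ S then 3 ^ (S.card - 1) * ‖c S‖ ^ 2 else 0 := by
    intro i
    rw [← Finset.sum_filter, sum_filter_mem_eq, weight, Finset.powerset_univ, Finset.sum_filter]
    refine Finset.sum_congr rfl fun S _ => ?_
    by_cases h : i ∈ S <;> simp [partialCoeff, h]
  simp_rw [h1]
  rw [Finset.sum_comm, Finset.mul_sum]
  refine Finset.sum_le_sum fun S _ => ?_
  rw [← Finset.sum_filter, Finset.sum_const, Finset.filter_mem_eq_inter, Finset.univ_inter,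
    nsmul_eq_mul]
  rcases lt_or_ge d S.card with h | h
  · simp [hc S h]
  · rw [← mul_assoc]
    gcongr
    · norm_num
    · omega

end Weights

/-- Cauchy–Schwarz: the quadratic `t ↦ ∫ (t f + g)²` is nonnegative, so its discriminant is not
positive. -/
theorem integral_mul_sq_le {Ω : Type*} [MeasurableSpace Ω] {μ : Measure Ω} {f g : Ω → ℝ}
    (hf : MemLp f 2 μ) (hg : MemLp g 2 μ) :
    (∫ ω, f ω * g ω ∂μ) ^ 2 ≤ (∫ ω, f ω ^ 2 ∂μ) * ∫ ω, g ω ^ 2 ∂μ := by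
  have hfg : Integrable (fun ω => f ω * g ω) μ := hf.integrable_mul hg
  have h : ∀ t : ℝ, 0 ≤ (∫ ω, f ω ^ 2 ∂μ) * (t * t) + (2 * ∫ ω, f ω * g ω ∂μ) * t
      + ∫ ω, g ω ^ 2 ∂μ := by
    intro t
    have h1 : 0 ≤ ∫ ω, (t * f ω + g ω) ^ 2 ∂μ := integral_nonneg fun _ => sq_nonneg _
    have h2 : ∫ ω, (t * f ω + g ω) ^ 2 ∂μ
        = ∫ ω, (t * t * f ω ^ 2 + 2 * t * (f ω * g ω) + g ω ^ 2) ∂μ :=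
      integral_congr_ae (.of_forall fun ω => by ring)
    have h3 : Integrable (fun ω => t * t * f ω ^ 2 + 2 * t * (f ω * g ω)) μ :=
      (hf.integrable_sq.const_mul _).add (hfg.const_mul _)
    rw [h2, integral_add h3 hg.integrable_sq, integral_add (hf.integrable_sq.const_mul _) (hfg.const_mul _), integral_const_mul,
      integral_const_mul] at h1
    linarith
  have := discrim_le_zero h
  unfold discrim at this
  linarith

/-! ### Moments of the standard Gaussian -/

section Moments

theorem hasDerivAt_mul_exp_sq {p : ℝ → ℝ} {p' t : ℝ} (hp : HasDerivAt p p' t) :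
    HasDerivAt (fun t => p t * Real.exp (t ^ 2 / 2)) ((p' + t * p t) * Real.exp (t ^ 2 / 2)) t := by
  have h1 : HasDerivAt (fun t : ℝ => t ^ 2 / 2) t t := by
    convert! (hasDerivAt_pow 2 t).div_const 2 using 1
    simp
  convert! hp.mul h1.exp using 1
  ring

/-- The function is the moment generating function of the standard Gaussian; its derivatives at zero
are the moments. -/
theorem iteratedDeriv_exp_sq :
    iteratedDeriv 1 (fun t : ℝ => Real.exp (t ^ 2 / 2)) = (fun t => t * Real.exp (t ^ 2 / 2)) ∧
    iteratedDeriv 2 (fun t : ℝ => Real.exp (t ^ 2 / 2))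
      = (fun t => (t ^ 2 + 1) * Real.exp (t ^ 2 / 2)) ∧
    iteratedDeriv 3 (fun t : ℝ => Real.exp (t ^ 2 / 2))
      = (fun t => (t ^ 3 + 3 * t) * Real.exp (t ^ 2 / 2)) ∧
    iteratedDeriv 4 (fun t : ℝ => Real.exp (t ^ 2 / 2))
      = (fun t => (t ^ 4 + 6 * t ^ 2 + 3) * Real.exp (t ^ 2 / 2)) := by
  have h1 : iteratedDeriv 1 (fun t : ℝ => Real.exp (t ^ 2 / 2))
      = (fun t => t * Real.exp (t ^ 2 / 2)) := by
    rw [iteratedDeriv_one]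
    funext t
    have := (hasDerivAt_mul_exp_sq (hasDerivAt_const t (1 : ℝ))).deriv
    simpa using this
  have h2 : iteratedDeriv 2 (fun t : ℝ => Real.exp (t ^ 2 / 2))
      = (fun t => (t ^ 2 + 1) * Real.exp (t ^ 2 / 2)) := by
    rw [iteratedDeriv_succ, h1]
    funext t
    rw [(hasDerivAt_mul_exp_sq (hasDerivAt_id' t)).deriv]
    ring
  have h3 : iteratedDeriv 3 (fun t : ℝ => Real.exp (t ^ 2 / 2))
      = (fun t => (t ^ 3 + 3 * t) * Real.exp (t ^ 2 / 2)) := by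
    rw [iteratedDeriv_succ, h2]
    funext t
    rw [(hasDerivAt_mul_exp_sq ((hasDerivAt_pow 2 t).add_const 1)).deriv]
    push_cast
    ring
  refine ⟨h1, h2, h3, ?_⟩
  rw [iteratedDeriv_succ, h3]
  funext t
  rw [(hasDerivAt_mul_exp_sq ((hasDerivAt_pow 3 t).fun_add ((hasDerivAt_id' t).const_mul 3))).deriv]
  push_cast
  ring

theorem integral_pow_gaussianReal (k : ℕ) :
    ∫ x, x ^ k ∂gaussianReal 0 1 = iteratedDeriv k (fun t : ℝ => Real.exp (t ^ 2 / 2)) 0 := by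
  have h := iteratedDeriv_mgf_zero (X := id) (μ := gaussianReal 0 1)
    (by simp [integrableExpSet_id_gaussianReal]) k
  rw [mgf_id_gaussianReal] at h
  simpa using h.symm

theorem integral_gaussianReal_one : ∫ x, x ^ 1 ∂gaussianReal 0 1 = 0 := by
  rw [integral_pow_gaussianReal, iteratedDeriv_exp_sq.1]; simp

theorem integral_sq_gaussianReal : ∫ x, x ^ 2 ∂gaussianReal 0 1 = 1 := by
  rw [integral_pow_gaussianReal, iteratedDeriv_exp_sq.2.1]; simp

theorem integral_cube_gaussianReal : ∫ x, x ^ 3 ∂gaussianReal 0 1 = 0 := by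
  rw [integral_pow_gaussianReal, iteratedDeriv_exp_sq.2.2.1]; simp

theorem integral_fourth_gaussianReal : ∫ x, x ^ 4 ∂gaussianReal 0 1 = 3 := by
  rw [integral_pow_gaussianReal, iteratedDeriv_exp_sq.2.2.2]; simp

variable {Ω : Type*} [MeasurableSpace Ω] {P : Measure Ω} {X : Ω → ℝ}

theorem memLp_of_hasLaw_gaussianReal (hX : HasLaw X (gaussianReal 0 1) P) {p : ℝ≥0∞}
    (hp : p ≠ ∞) : MemLp X p P := by
  have h := memLp_id_gaussianReal' (μ := 0) (v := 1) p hp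
  rw [← hX.map_eq] at h
  exact h.comp_of_map hX.aemeasurable

theorem integral_pow_of_hasLaw (hX : HasLaw X (gaussianReal 0 1) P) (k : ℕ) :
    ∫ ω, X ω ^ k ∂P = ∫ x, x ^ k ∂gaussianReal 0 1 := by
  rw [← hX.map_eq, integral_map hX.aemeasurable (by fun_prop)]

theorem integrable_pow_of_hasLaw [IsFiniteMeasure P] (hX : HasLaw X (gaussianReal 0 1) P)
    (k : ℕ) : Integrable (fun ω => X ω ^ k) P := by
  have := (memLp_of_hasLaw_gaussianReal hX (p := k) (by simp)).integrable_norm_pow'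
  refine (this.mono' (hX.aemeasurable.pow_const k).aestronglyMeasurable ?_)
  exact .of_forall fun ω => by simp

end Moments

/-! ### Hypercontractivity: the fourth moment of a multilinear polynomial -/

section Hypercontractivity

variable {Ω ι E : Type*} [MeasurableSpace Ω] {P : Measure Ω}
  [NormedAddCommGroup E] [InnerProductSpace ℝ E] {z : ι → Ω → ℝ}

theorem continuous_mlin (A : Finset ι) (c : Finset ι → E) : Continuous (mlin A c) := by
  unfold mlin
  fun_prop

theorem memLp_prod [IsProbabilityMeasure P] (hz : ∀ i, HasLaw (z i) (gaussianReal 0 1) P)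
    (S : Finset ι) (k : ℕ) :
    MemLp (fun ω => ∏ i ∈ S, z i ω) k P := by
  have h1 := MemLp.prod' (s := S) (μ := P) (f := z)
    -- By Hölder the product lies in `L^p` with `p = k (|S| + 1) / |S|`, which is at least `k`; on a
    -- probability space that suffices.
    (p := fun _ => k * ((S.card : ℝ≥0∞) + 1))
    (fun i _ => memLp_of_hasLaw_gaussianReal (hz i) (ENNReal.mul_ne_top (by simp) (by simp)))
  refine h1.mono_exponent ?_
  rw [ENNReal.le_inv_iff_le_inv, Finset.sum_const, nsmul_eq_mul]
  rw [ENNReal.mul_inv (by simp) (by simp), mul_left_comm]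
  refine mul_le_of_le_one_right (by simp) ?_
  rw [← div_eq_mul_inv]
  exact ENNReal.div_le_of_le_mul (by simp)

theorem memLp_mlin [IsProbabilityMeasure P] (hz : ∀ i, HasLaw (z i) (gaussianReal 0 1) P)
    (A : Finset ι) (c : Finset ι → E) (k : ℕ) : MemLp (fun ω => mlin A c (fun i => z i ω)) k P :=
  memLp_finsetSum _ fun S _ =>
    (ContinuousLinearMap.toSpanSingleton ℝ (c S)).comp_memLp' (memLp_prod hz S k)

/-- A variable outside `A` is independent of a continuous function of the variables in `A`. -/
theorem indepFun_of_congr (hz : ∀ i, HasLaw (z i) (gaussianReal 0 1) P) (hind : iIndepFun z P)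
    {a : ι} {A : Finset ι} (ha : a ∉ A) {Φ : (ι → ℝ) → ℝ} (hΦ : Continuous Φ)
    (hA : ∀ x y : ι → ℝ, (∀ i ∈ A, x i = y i) → Φ x = Φ y) (k : ℕ) :
    IndepFun (fun ω => z a ω ^ k) (fun ω => Φ (fun i => z i ω)) P := by
  classical
  have h := hind.indepFun_finset₀ {a} A (by simpa using ha) fun i => (hz i).aemeasurable
  have hext : Continuous fun (w : A → ℝ) (i : ι) => if hi : i ∈ A then w ⟨i, hi⟩ else 0 := by
    refine continuous_pi fun i => ?_
    by_cases hi : i ∈ A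
    · simpa [hi] using continuous_apply _
    · simpa [hi] using continuous_const
  have h2 := h.comp (φ := fun w : ({a} : Finset ι) → ℝ => w ⟨a, by simp⟩ ^ k)
    (ψ := fun w : A → ℝ => Φ fun i => if hi : i ∈ A then w ⟨i, hi⟩ else 0)
    (by fun_prop) (hΦ.comp hext).measurable
  convert! h2 using 1
  funext ω
  exact hA _ _ fun i hi => by simp [hi]

/-- Grouped by powers of `g`: when `g` is Gaussian and independent of `R` and `D`, the odd powers
average to zero and the even ones to 1 and 3. -/
theorem norm_add_smul_pow_four (R D : E) (g : ℝ) :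
    ‖R + g • D‖ ^ 4 = ‖R‖ ^ 4 + g ^ 2 * (4 * inner ℝ R D ^ 2 + 2 * (‖R‖ ^ 2 * ‖D‖ ^ 2))
      + g ^ 4 * ‖D‖ ^ 4 + g ^ 1 * (4 * ‖R‖ ^ 2 * inner ℝ R D)
      + g ^ 3 * (4 * inner ℝ R D * ‖D‖ ^ 2) := by
  have h : ‖R + g • D‖ ^ 2 = ‖R‖ ^ 2 + 2 * (g * inner ℝ R D) + g ^ 2 * ‖D‖ ^ 2 := by
    rw [norm_add_sq_real, real_inner_smul_right, norm_smul, mul_pow, Real.norm_eq_abs, sq_abs]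
  rw [show ‖R + g • D‖ ^ 4 = (‖R + g • D‖ ^ 2) ^ 2 by ring, h]
  ring

/-- Induction on the variables. Writing the polynomial as `R + z_a D`, with weights `W` and `W'` for
`R` and `D`, independence and Cauchy–Schwarz bound the fourth moment by `W² + 6 W W' + 3 W'²`, which
is at most `(W + 3 W')²`. The base 3 of the weight is what makes the cross term fit. -/
theorem integral_norm_mlin_pow_four_le [Finite ι] [IsProbabilityMeasure P]
    (hz : ∀ i, HasLaw (z i) (gaussianReal 0 1) P)
    (hind : iIndepFun z P) (A : Finset ι) (c : Finset ι → E) :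
    ∫ ω, ‖mlin A c (fun i => z i ω)‖ ^ 4 ∂P ≤ weight A c ^ 2 := by
  classical
  induction A using Finset.induction_on generalizing c with
  | empty =>
    simp only [mlin, weight, Finset.powerset_empty, Finset.sum_singleton, Finset.prod_empty,
      one_smul, Finset.card_empty, pow_zero, one_mul, integral_const, probReal_univ]
    exact le_of_eq (by ring)
  | insert a A ha ih =>
    set c' : Finset ι → E := fun S => c (insert a S) with hc'
    set R : (ι → ℝ) → E := mlin A c
    set D : (ι → ℝ) → E := mlin A c'
    have hR : Continuous R := continuous_mlin A c
    have hD : Continuous D := continuous_mlin A c'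
    have hR4 : Integrable (fun ω => ‖R (fun i => z i ω)‖ ^ 4) P :=
      (memLp_mlin hz A c 4).integrable_norm_pow (by simp)
    have hD4 : Integrable (fun ω => ‖D (fun i => z i ω)‖ ^ 4) P :=
      (memLp_mlin hz A c' 4).integrable_norm_pow (by simp)
    have hcomp : ∀ {Φ : (ι → ℝ) → ℝ}, Continuous Φ →
        AEStronglyMeasurable (fun ω => Φ (fun i => z i ω)) P := fun hΦ =>
      hΦ.comp_aestronglyMeasurable
        (aemeasurable_pi_lambda _ fun i => (hz i).aemeasurable).aestronglyMeasurable
    -- Independence of `z a` from `(R, D)` splits off the Gaussian moment; domination by fourth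
    -- powers supplies integrability.
    have key : ∀ (φ : E → E → ℝ), Continuous (Function.uncurry φ) →
        (∀ r s, |φ r s| ≤ 6 * (‖r‖ ^ 4 + ‖s‖ ^ 4)) → ∀ k : ℕ,
        Integrable (fun ω => z a ω ^ k * φ (R fun i => z i ω) (D fun i => z i ω)) P ∧
        ∫ ω, z a ω ^ k * φ (R fun i => z i ω) (D fun i => z i ω) ∂P
          = (∫ x, x ^ k ∂gaussianReal 0 1) *
            ∫ ω, φ (R fun i => z i ω) (D fun i => z i ω) ∂P := by
      intro φ hφ hb k
      have hcont : Continuous fun x => φ (R x) (D x) := hφ.comp (hR.prodMk hD)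
      have hi := indepFun_of_congr hz hind ha hcont
        (fun x y h => by simp only [R, D, mlin_congr _ h]) k
      have hφi : Integrable (fun ω => φ (R fun i => z i ω) (D fun i => z i ω)) P := by
        refine ((hR4.add hD4).const_mul 6).mono' (hcomp hcont) (.of_forall fun ω => ?_)
        exact hb _ _
      refine ⟨hi.integrable_mul (integrable_pow_of_hasLaw (hz a) k) hφi, ?_⟩
      rw [← integral_pow_of_hasLaw (hz a)]
      exact hi.integral_mul_eq_mul_integral ((hz a).aemeasurable.pow_const k).aestronglyMeasurable
        (hcomp hcont)
    have hin : ∀ r s : E, |inner ℝ r s| ≤ ‖r‖ * ‖s‖ := abs_real_inner_le_norm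
    have hb1 : ∀ r s : E, |inner ℝ r s ^ 2| ≤ ‖r‖ ^ 2 * ‖s‖ ^ 2 := fun r s => by
      rw [abs_pow, ← mul_pow]
      gcongr
      exact hin r s
    have hb0 : ∀ x y : ℝ, x ^ 2 * y ^ 2 ≤ (x ^ 4 + y ^ 4) / 2 := fun x y => by
      nlinarith [sq_nonneg (x ^ 2 - y ^ 2)]
    have hb3 : ∀ x y : ℝ, 0 ≤ x → 0 ≤ y → x ^ 3 * y ≤ x ^ 4 + y ^ 4 := fun x y hx hy => by
      nlinarith [sq_nonneg (x ^ 2 - x * y), sq_nonneg (x ^ 2 - y ^ 2), sq_nonneg (x * y)]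
    obtain ⟨i2, e2⟩ := key (fun r s => 4 * inner ℝ r s ^ 2 + 2 * (‖r‖ ^ 2 * ‖s‖ ^ 2))
      (by fun_prop) (fun r s => by
        rw [abs_of_nonneg (by positivity)]
        have := le_of_abs_le (hb1 r s)
        have := hb0 ‖r‖ ‖s‖
        have : (0 : ℝ) ≤ ‖r‖ ^ 4 + ‖s‖ ^ 4 := by positivity
        linarith) 2
    obtain ⟨i4, e4⟩ := key (fun r s => ‖s‖ ^ 4) (by fun_prop) (fun r s => by
        rw [abs_of_nonneg (by positivity)]
        have : (0 : ℝ) ≤ ‖r‖ ^ 4 := by positivity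
        have : (0 : ℝ) ≤ ‖s‖ ^ 4 := by positivity
        linarith) 4
    obtain ⟨i1, e1⟩ := key (fun r s => 4 * ‖r‖ ^ 2 * inner ℝ r s) (by fun_prop) (fun r s => by
        rw [abs_mul, abs_of_nonneg (by positivity)]
        have h1 := mul_le_mul_of_nonneg_left (hin r s) (by positivity : 0 ≤ 4 * ‖r‖ ^ 2)
        have h2 := hb3 ‖r‖ ‖s‖ (norm_nonneg _) (norm_nonneg _)
        have : (0 : ℝ) ≤ ‖r‖ ^ 4 + ‖s‖ ^ 4 := by positivity
        linarith) 1
    obtain ⟨i3, e3⟩ := key (fun r s => 4 * inner ℝ r s * ‖s‖ ^ 2) (by fun_prop) (fun r s => by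
        rw [abs_mul, abs_mul, abs_of_nonneg (by positivity : (0 : ℝ) ≤ ‖s‖ ^ 2),
          abs_of_nonneg (by norm_num : (0 : ℝ) ≤ 4)]
        have h1 := mul_le_mul_of_nonneg_right (hin r s) (by positivity : 0 ≤ 4 * ‖s‖ ^ 2)
        have h2 := hb3 ‖s‖ ‖r‖ (norm_nonneg _) (norm_nonneg _)
        have : (0 : ℝ) ≤ ‖r‖ ^ 4 + ‖s‖ ^ 4 := by positivity
        linarith) 3
    have i12 := hR4.add i2
    have i124 := i12.add i4
    have i1241 := i124.add i1
    have hexp : ∫ ω, ‖mlin (insert a A) c (fun i => z i ω)‖ ^ 4 ∂P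
        = ∫ ω, ‖R (fun i => z i ω)‖ ^ 4 ∂P
          + ∫ ω, (4 * inner ℝ (R fun i => z i ω) (D fun i => z i ω) ^ 2
            + 2 * (‖R fun i => z i ω‖ ^ 2 * ‖D fun i => z i ω‖ ^ 2)) ∂P
          + 3 * ∫ ω, ‖D (fun i => z i ω)‖ ^ 4 ∂P := by
      simp_rw [mlin_insert ha, norm_add_smul_pow_four]
      rw [integral_add, integral_add, integral_add, integral_add, e1, e2, e3, e4,
        integral_gaussianReal_one, integral_sq_gaussianReal, integral_cube_gaussianReal,
        integral_fourth_gaussianReal]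
      · ring
      all_goals assumption
    have hRD : (∫ ω, ‖R fun i => z i ω‖ ^ 2 * ‖D fun i => z i ω‖ ^ 2 ∂P)
        ≤ weight A c * weight A c' := by
      refine le_of_sq_le_sq ?_ (mul_nonneg (weight_nonneg _ _) (weight_nonneg _ _))
      refine (integral_mul_sq_le ?_ ?_).trans ?_
      · refine (memLp_two_iff_integrable_sq (hcomp (Φ := fun x => ‖R x‖ ^ 2) (by fun_prop))).2 ?_
        simpa only [← pow_mul] using hR4
      · refine (memLp_two_iff_integrable_sq (hcomp (Φ := fun x => ‖D x‖ ^ 2) (by fun_prop))).2 ?_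
        simpa only [← pow_mul] using hD4
      · simp_rw [← pow_mul]
        rw [mul_pow]
        exact mul_le_mul (ih c) (ih c') (integral_nonneg fun _ => by positivity) (by positivity)
    have hRDi : Integrable (fun ω => ‖R fun i => z i ω‖ ^ 2 * ‖D fun i => z i ω‖ ^ 2) P := by
      refine (hR4.add hD4).mono' (hcomp (Φ := fun x => ‖R x‖ ^ 2 * ‖D x‖ ^ 2) (by fun_prop))
        (.of_forall fun ω => ?_)
      rw [Real.norm_of_nonneg (by positivity)]
      refine (hb0 _ _).trans ?_
      have : (0 : ℝ) ≤ ‖R fun i => z i ω‖ ^ 4 + ‖D fun i => z i ω‖ ^ 4 := by positivity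
      simp only [Pi.add_apply]
      linarith
    have hmid : ∫ ω, (4 * inner ℝ (R fun i => z i ω) (D fun i => z i ω) ^ 2
            + 2 * (‖R fun i => z i ω‖ ^ 2 * ‖D fun i => z i ω‖ ^ 2)) ∂P
        ≤ 6 * (weight A c * weight A c') := by
      refine le_trans ?_ (mul_le_mul_of_nonneg_left hRD (by norm_num))
      rw [← integral_const_mul]
      refine integral_mono_of_nonneg (.of_forall fun ω => by positivity) (hRDi.const_mul 6)
        (.of_forall fun ω => ?_)
      have := le_of_abs_le (hb1 (R fun i => z i ω) (D fun i => z i ω))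
      dsimp only
      linarith
    rw [hexp, weight_insert ha]
    have h1 := ih c
    have h2 := ih c'
    nlinarith [weight_nonneg A c, weight_nonneg A c', sq_nonneg (weight A c')]

end Hypercontractivity

/-- The integral factors over coordinates. One lying in exactly one of `S` and `T` contributes a
zero mean, one in both contributes `r`, and one in neither contributes 1. -/
theorem integral_prod_mul_prod_pi {X ι : Type*} [MeasurableSpace X] {ν : Measure X} [Fintype ι]
    [DecidableEq ι] [IsProbabilityMeasure ν] {a b : X → ℝ} {r : ℝ} (ha : ∫ x, a x ∂ν = 0)
    (hb : ∫ x, b x ∂ν = 0) (hab : ∫ x, a x * b x ∂ν = r) (S T : Finset ι) :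
    ∫ x, (∏ i ∈ S, a (x i)) * ∏ i ∈ T, b (x i) ∂(Measure.pi fun _ : ι => ν)
      = if S = T then r ^ S.card else 0 := by
  have h1 : ∀ x : ι → X, (∏ i ∈ S, a (x i)) * ∏ i ∈ T, b (x i)
      = ∏ i, (if i ∈ S then a (x i) else 1) * if i ∈ T then b (x i) else 1 := by
    intro x
    rw [Finset.prod_mul_distrib, Fintype.prod_ite_mem, Fintype.prod_ite_mem]
  simp_rw [h1]
  rw [integral_fintype_prod_eq_prod (f := fun i (y : X) => (if i ∈ S then a y else 1) *
    if i ∈ T then b y else 1)]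
  split_ifs with h
  · subst h
    have h2 : ∀ i, (∫ y, (if i ∈ S then a y else 1) * (if i ∈ S then b y else 1) ∂ν)
        = if i ∈ S then r else 1 := by
      intro i
      by_cases hi : i ∈ S <;> simp [hi, hab]
    simp_rw [h2]
    rw [Fintype.prod_ite_mem, Finset.prod_const]
  · obtain ⟨i, hi⟩ : ∃ i, ¬(i ∈ S ↔ i ∈ T) := by
      by_contra hcon
      push Not at hcon
      exact h (Finset.ext hcon)
    refine Finset.prod_eq_zero (Finset.mem_univ i) ?_
    by_cases hS : i ∈ S
    · have hT : i ∉ T := fun hT => hi ⟨fun _ => hT, fun _ => hS⟩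
      simp [hS, hT, ha]
    · have hT : i ∈ T := by tauto
      simp [hS, hT, hb]

/-! ### Linear forms in independent Gaussians -/

section LinearForms

variable {κ : Type*} [Fintype κ]

/-- The law of a vector of independent standard Gaussians. -/
abbrev gaussPi (κ : Type*) [Fintype κ] : Measure (κ → ℝ) := Measure.pi fun _ => gaussianReal 0 1

instance isGaussian_pi {X : κ → Type*} [∀ i, NormedAddCommGroup (X i)]
    [∀ i, NormedSpace ℝ (X i)] [∀ i, MeasurableSpace (X i)] [∀ i, BorelSpace (X i)]
    [∀ i, CompleteSpace (X i)] [∀ i, SecondCountableTopology (X i)]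
    (μ : ∀ i, Measure (X i)) [∀ i, IsGaussian (μ i)] : IsGaussian (Measure.pi μ) := by
  have h : iIndepFun (fun i (x : ∀ i, X i) => x i) (Measure.pi μ) :=
    iIndepFun_pi (X := fun _ => id) fun _ => aemeasurable_id
  have h2 := h.hasGaussianLaw fun i => (measurePreserving_eval μ i).hasLaw.hasGaussianLaw
  simpa using h2.isGaussian_map

theorem memLp_sum_mul (u : κ → ℝ) : MemLp (fun r : κ → ℝ => ∑ j, r j * u j) 2 (gaussPi κ) :=
  memLp_finsetSum _ fun j _ => ((IsGaussian.memLp_two_id (μ := gaussianReal 0 1)).comp_measurePreserving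
    (measurePreserving_eval _ j)).mul_const _

theorem integral_sum_mul (u : κ → ℝ) : ∫ r : κ → ℝ, ∑ j, r j * u j ∂gaussPi κ = 0 := by
  rw [integral_finsetSum _ fun j _ => (integrable_eval IsGaussian.integrable_id).mul_const _]
  simp [integral_mul_const, integral_eval]

theorem integral_sum_mul_sq (u : κ → ℝ) :
    ∫ r : κ → ℝ, (∑ j, r j * u j) ^ 2 ∂gaussPi κ = ∑ j, u j ^ 2 := by
  have h := variance_of_integral_eq_zero (memLp_sum_mul u).aestronglyMeasurable.aemeasurable
    (integral_sum_mul u)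
  rw [← h]
  have h2 : (fun r : κ → ℝ => ∑ j, r j * u j) = ∑ j, fun r : κ → ℝ => r j * u j := by
    ext; simp
  rw [h2, variance_sum_pi (X := fun j (x : ℝ) => x * u j)
    fun j => IsGaussian.memLp_two_id.mul_const _]
  refine Finset.sum_congr rfl fun j _ => ?_
  rw [variance_mul_const]
  change Var[id; _] * _ = _
  simp

theorem integral_sum_mul_mul_sum_mul (u v : κ → ℝ) :
    ∫ r : κ → ℝ, (∑ j, r j * u j) * (∑ j, r j * v j) ∂gaussPi κ = ∑ j, u j * v j := by
  -- Polarization reduces the mixed moment to second moments.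
  have h1 : ∀ r : κ → ℝ, (∑ j, r j * u j) * (∑ j, r j * v j)
      = ((∑ j, r j * (u + v) j) ^ 2 - (∑ j, r j * (u - v) j) ^ 2) * (1 / 4) := by
    intro r
    simp only [Pi.add_apply, Pi.sub_apply, mul_add, mul_sub, Finset.sum_add_distrib,
      Finset.sum_sub_distrib]
    ring
  simp_rw [h1]
  rw [integral_mul_const, integral_sub (memLp_sum_mul _).integrable_sq
    (memLp_sum_mul _).integrable_sq, integral_sum_mul_sq, integral_sum_mul_sq,
    ← Finset.sum_sub_distrib, Finset.sum_mul]
  refine Finset.sum_congr rfl fun j _ => ?_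
  simp only [Pi.add_apply, Pi.sub_apply]
  ring

/-- A continuous functional of a Gaussian vector is Gaussian, hence determined by its mean and
variance. -/
theorem hasLaw_sum_mul {u : κ → ℝ} (hu : ∑ j, u j ^ 2 = 1) :
    HasLaw (fun r : κ → ℝ => ∑ j, r j * u j) (gaussianReal 0 1) (gaussPi κ) := by
  let L : StrongDual ℝ (κ → ℝ) := ∑ j, u j • ContinuousLinearMap.proj j
  have hL : (L : (κ → ℝ) → ℝ) = fun r => ∑ j, r j * u j := by
    ext r
    simp [L, mul_comm]
  have h := IsGaussian.map_eq_gaussianReal (μ := gaussPi κ) L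
  rw [hL, integral_sum_mul, variance_of_integral_eq_zero
    (memLp_sum_mul u).aestronglyMeasurable.aemeasurable (integral_sum_mul u),
    integral_sum_mul_sq, hu, Real.toNNReal_one] at h
  exact ⟨(memLp_sum_mul u).aestronglyMeasurable.aemeasurable, h⟩

end LinearForms

/-! ### Gaussian matrices acting on vectors -/

section GaussMatrix

variable {n k : ℕ}

/-- The coordinates of the product of a matrix with a vector. -/
def act (M : Fin n → Fin k → ℝ) (u : EuclideanSpace ℝ (Fin k)) (i : Fin n) : ℝ :=
  ∑ j, M i j * u j

instance : IsGaussian (gaussMatrix n k) := by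
  unfold gaussMatrix
  infer_instance

theorem hasLaw_act {u : EuclideanSpace ℝ (Fin k)} (hu : ‖u‖ = 1) (i : Fin n) :
    HasLaw (fun M => act M u i) (gaussianReal 0 1) (gaussMatrix n k) := by
  refine (hasLaw_sum_mul (u := u) ?_).comp
    (measurePreserving_eval (fun _ : Fin n => gaussPi (Fin k)) i).hasLaw
  rw [← EuclideanSpace.real_norm_sq_eq, hu, one_pow]

theorem iIndepFun_act (u : EuclideanSpace ℝ (Fin k)) :
    iIndepFun (fun i M => act M u i) (gaussMatrix n k) :=
  iIndepFun_pi (X := fun _ (r : Fin k → ℝ) => ∑ j, r j * u j) fun _ =>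
    Measurable.aemeasurable (by fun_prop)

theorem integral_prod_act_mul_prod_act (u v : EuclideanSpace ℝ (Fin k)) (S T : Finset (Fin n)) :
    ∫ M, (∏ i ∈ S, act M u i) * ∏ i ∈ T, act M v i ∂gaussMatrix n k
      = if S = T then inner ℝ u v ^ S.card else 0 := by
  refine integral_prod_mul_prod_pi (a := fun r : Fin k → ℝ => ∑ j, r j * u j)
    (b := fun r : Fin k → ℝ => ∑ j, r j * v j)
    (integral_sum_mul _) (integral_sum_mul _) ?_ S T
  rw [integral_sum_mul_mul_sum_mul, PiLp.inner_apply]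
  exact Finset.sum_congr rfl fun j _ => by simp [mul_comm]

theorem memLp_linearForm_row (a : Fin n → Fin k → ℝ) (i : Fin n) :
    MemLp (fun M : Fin n → Fin k → ℝ => ∑ j, M i j * a i j) 2 (gaussMatrix n k) :=
  (memLp_sum_mul (a i)).comp_measurePreserving (measurePreserving_eval _ i)

theorem memLp_linearForm (a : Fin n → Fin k → ℝ) :
    MemLp (fun M : Fin n → Fin k → ℝ => ∑ i, ∑ j, M i j * a i j) 2 (gaussMatrix n k) :=
  memLp_finsetSum _ fun i _ => memLp_linearForm_row a i

theorem integral_linearForm (a : Fin n → Fin k → ℝ) :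
    ∫ M, ∑ i, ∑ j, M i j * a i j ∂gaussMatrix n k = 0 := by
  rw [integral_finsetSum _ fun i _ => (memLp_linearForm_row a i).integrable one_le_two]
  refine Finset.sum_eq_zero fun i _ => ?_
  have := integral_comp_eval (μ := fun _ : Fin n => gaussPi (Fin k)) (i := i)
    (memLp_sum_mul (a i)).aestronglyMeasurable
  rw [integral_sum_mul] at this
  exact this

theorem integral_linearForm_sq (a : Fin n → Fin k → ℝ) :
    ∫ M, (∑ i, ∑ j, M i j * a i j) ^ 2 ∂gaussMatrix n k = ∑ i, ∑ j, a i j ^ 2 := by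
  rw [← variance_of_integral_eq_zero (Measurable.aemeasurable (by fun_prop))
    (integral_linearForm a)]
  have h2 : (fun M : Fin n → Fin k → ℝ => ∑ i, ∑ j, M i j * a i j)
      = ∑ i, fun M : Fin n → Fin k → ℝ => ∑ j, M i j * a i j := by
    ext; simp
  rw [h2]
  refine (variance_sum_pi fun i => memLp_sum_mul (a i)).trans (Finset.sum_congr rfl fun i _ => ?_)
  rw [variance_of_integral_eq_zero (memLp_sum_mul (a i)).aestronglyMeasurable.aemeasurable
    (integral_sum_mul _), integral_sum_mul_sq]

/-- Centredness, in the form required for rotation invariance of the product of two copies. -/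
theorem integral_strongDual_gaussMatrix (L : StrongDual ℝ (Fin n → Fin k → ℝ)) :
    ∫ M, L M ∂gaussMatrix n k = 0 := by
  rw [← integral_linearForm fun i j => L (Pi.single i (Pi.single j 1))]
  congr 1
  funext M
  have h : M = ∑ i, ∑ j, M i j • (Pi.single i (Pi.single j 1) : Fin n → Fin k → ℝ) := by
    ext i j
    simp [Finset.sum_apply, Pi.single_apply, Finset.sum_ite_eq, apply_ite, ite_apply]
  conv_lhs => rw [h]
  simp [map_sum]

end GaussMatrix

theorem enorm_sq_eq_ofReal (x : ℝ) : ‖x‖ₑ ^ 2 = ENNReal.ofReal (x ^ 2) := by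
  rw [Real.enorm_eq_ofReal_abs, ← ENNReal.ofReal_pow (abs_nonneg x), sq_abs]

/-- Cauchy–Schwarz against the constant 1, in extended nonnegative form so that `f` need not be
integrable. -/
theorem enorm_integral_sq_le {Ω : Type*} [MeasurableSpace Ω] {ν : Measure Ω}
    {f : Ω → ℝ} (hf : AEStronglyMeasurable f ν) :
    ‖∫ ω, f ω ∂ν‖ₑ ^ 2 ≤ ν Set.univ * ∫⁻ ω, ‖f ω‖ₑ ^ 2 ∂ν := by
  have h1 := enorm_integral_le_lintegral_enorm (μ := ν) f
  rw [← eLpNorm_one_eq_lintegral_enorm] at h1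
  have h2 := h1.trans (eLpNorm_le_eLpNorm_mul_rpow_measure_univ (p := 1) (q := 2)
    (by norm_num) hf)
  have h3 : eLpNorm f 2 ν ^ 2 = ∫⁻ ω, ‖f ω‖ₑ ^ 2 ∂ν := by
    have := eLpNorm_nnreal_pow_eq_lintegral (f := f) (μ := ν) (p := 2) (by norm_num)
    simpa using this
  refine (pow_le_pow_left' h2 2).trans_eq ?_
  rw [mul_pow, h3, mul_comm, ← ENNReal.rpow_natCast (ν Set.univ ^ _), ← ENNReal.rpow_mul]
  norm_num

theorem integral_sq_eq_of_lintegral {Ω : Type*} [MeasurableSpace Ω] {ν : Measure Ω}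
    {f : Ω → ℝ} (hf : MemLp f 2 ν) :
    ∫⁻ ω, ‖f ω‖ₑ ^ 2 ∂ν = ENNReal.ofReal (∫ ω, f ω ^ 2 ∂ν) := by
  simp_rw [enorm_sq_eq_ofReal]
  exact (ofReal_integral_eq_lintegral_ofReal hf.integrable_sq
    (.of_forall fun _ => sq_nonneg _)).symm

/-! ### Isotropic pairs of unit vectors -/

/-- A law of pairs of unit vectors whose two marginals have covariance `1 / k`. -/
structure IsSphericalPair {k : ℕ}
    (μ : Measure (EuclideanSpace ℝ (Fin k) × EuclideanSpace ℝ (Fin k))) : Prop where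
  norm_fst : ∀ᵐ w ∂μ, ‖w.1‖ = 1
  norm_snd : ∀ᵐ w ∂μ, ‖w.2‖ = 1
  isotropic_fst : ∀ a, ∫ w, inner ℝ a w.1 ^ 2 ∂μ = ‖a‖ ^ 2 / k
  isotropic_snd : ∀ a, ∫ w, inner ℝ a w.2 ^ 2 ∂μ = ‖a‖ ^ 2 / k

section Spherical

variable {k : ℕ} {μ : Measure (EuclideanSpace ℝ (Fin k) × EuclideanSpace ℝ (Fin k))}

theorem IsSphericalPair.ae_mem (hμ : IsSphericalPair μ) :
    ∀ᵐ w ∂μ, w ∈ Metric.closedBall (0 : EuclideanSpace ℝ (Fin k)) 1 ×ˢ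
      Metric.closedBall (0 : EuclideanSpace ℝ (Fin k)) 1 := by
  filter_upwards [hμ.norm_fst, hμ.norm_snd] with w h1 h2
  simp [h1, h2]

variable [IsProbabilityMeasure μ]

/-- The law is carried by a compact product of unit balls, where continuous functions are bounded.
-/
theorem IsSphericalPair.integrable (hμ : IsSphericalPair μ)
    {f : EuclideanSpace ℝ (Fin k) × EuclideanSpace ℝ (Fin k) → ℝ} (hf : Continuous f) :
    Integrable f μ := by
  have h := hf.continuousOn.integrableOn_compact (μ := μ)
    ((isCompact_closedBall (0 : EuclideanSpace ℝ (Fin k)) 1).prod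
      (isCompact_closedBall (0 : EuclideanSpace ℝ (Fin k)) 1))
  rwa [IntegrableOn, Measure.restrict_eq_self_of_ae_mem hμ.ae_mem] at h

theorem IsSphericalPair.memLp (hμ : IsSphericalPair μ)
    {f : EuclideanSpace ℝ (Fin k) × EuclideanSpace ℝ (Fin k) → ℝ} (hf : Continuous f) :
    MemLp f 2 μ :=
  (memLp_two_iff_integrable_sq hf.aestronglyMeasurable).2 (hμ.integrable (hf.pow 2))

theorem IsSphericalPair.integrable_interval (hμ : IsSphericalPair μ) {a b : ℝ}
    {f : ℝ × (EuclideanSpace ℝ (Fin k) × EuclideanSpace ℝ (Fin k)) → ℝ} (hf : Continuous f) :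
    Integrable f ((volume.restrict (Set.uIoc a b)).prod μ) := by
  have h := hf.continuousOn.integrableOn_compact
    (μ := (volume.restrict (Set.uIoc a b)).prod μ)
    ((isCompact_uIcc (a := a) (b := b)).prod
      ((isCompact_closedBall (0 : EuclideanSpace ℝ (Fin k)) 1).prod
        (isCompact_closedBall (0 : EuclideanSpace ℝ (Fin k)) 1)))
  rwa [IntegrableOn, ← Measure.prod_restrict, Measure.restrict_eq_self_of_ae_mem hμ.ae_mem,
    Measure.restrict_eq_self_of_ae_mem] at h
  filter_upwards [ae_restrict_mem measurableSet_uIoc] with t ht using Set.uIoc_subset_uIcc ht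

/-- Bessel's inequality for the coordinates of an isotropic vector. -/
theorem sum_integral_coord_mul_sq_le (hμ : IsSphericalPair μ)
    {φ : EuclideanSpace ℝ (Fin k) × EuclideanSpace ℝ (Fin k) → EuclideanSpace ℝ (Fin k)}
    (hφ : Continuous φ) (hiso : ∀ a, ∫ w, inner ℝ a (φ w) ^ 2 ∂μ = ‖a‖ ^ 2 / k)
    {f : EuclideanSpace ℝ (Fin k) × EuclideanSpace ℝ (Fin k) → ℝ} (hf : Continuous f) :
    ∑ j, (∫ w, φ w j * f w ∂μ) ^ 2 ≤ (∫ w, f w ^ 2 ∂μ) / k := by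
  -- Test against the coefficient vector itself: `‖a‖² = ∫ ⟨a, φ⟩ f`, so Cauchy–Schwarz and isotropy
  -- give `‖a‖⁴ ≤ (‖a‖² / k) ∫ f²`. Then cancel `‖a‖²`, treating `a = 0` separately.
  set a : EuclideanSpace ℝ (Fin k) := WithLp.toLp 2 fun j => ∫ w, φ w j * f w ∂μ with ha
  have h1 : ∑ j, (∫ w, φ w j * f w ∂μ) ^ 2 = ‖a‖ ^ 2 := by
    rw [EuclideanSpace.real_norm_sq_eq]
  have h2 : ∫ w, inner ℝ a (φ w) * f w ∂μ = ‖a‖ ^ 2 := by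
    have h3 : ∀ w, inner ℝ a (φ w) * f w = ∑ j, a j * (φ w j * f w) := by
      intro w
      rw [PiLp.inner_apply, Finset.sum_mul]
      exact Finset.sum_congr rfl fun j _ => by simp; ring
    simp_rw [h3]
    rw [integral_finsetSum _ fun j _ => hμ.integrable (by fun_prop),
      EuclideanSpace.real_norm_sq_eq]
    refine Finset.sum_congr rfl fun j _ => ?_
    rw [integral_const_mul, sq]
  have h4 := integral_mul_sq_le (hμ.memLp (f := fun w => inner ℝ a (φ w)) (by fun_prop))
    (hμ.memLp hf)
  rw [h2, hiso] at h4
  rw [h1]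
  rcases eq_or_lt_of_le (sq_nonneg ‖a‖) with h0 | h0
  · rw [← h0]
    exact div_nonneg (integral_nonneg fun _ => sq_nonneg _) (Nat.cast_nonneg k)
  · rw [div_mul_eq_mul_div, mul_div_assoc, sq (‖a‖ ^ 2)] at h4
    exact le_of_mul_le_mul_left h4 h0

end Spherical

/-! ### Bilinear pairings of two polynomials in one Gaussian matrix -/

section Pairing

variable {n k : ℕ} {E : Type*} [NormedAddCommGroup E] [InnerProductSpace ℝ E]

/-- The pairing of two multilinear polynomials evaluated at the images of `w.1` and `w.2`. -/
def pairVal (B : E →L[ℝ] E →L[ℝ] ℝ) (c e : Finset (Fin n) → E) (M : Fin n → Fin k → ℝ)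
    (w : EuclideanSpace ℝ (Fin k) × EuclideanSpace ℝ (Fin k)) : ℝ :=
  B (mlin Finset.univ c (act M w.1)) (mlin Finset.univ e (act M w.2))

/-- The derivative of `pairVal` at `M` in the direction `M'`. -/
def pairDeriv (B : E →L[ℝ] E →L[ℝ] ℝ) (c e : Finset (Fin n) → E) (M M' : Fin n → Fin k → ℝ)
    (w : EuclideanSpace ℝ (Fin k) × EuclideanSpace ℝ (Fin k)) : ℝ :=
  ∑ i, (act M' w.1 i * pairVal B (partialCoeff i c) e M w
    + act M' w.2 i * pairVal B c (partialCoeff i e) M w)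

variable (B : E →L[ℝ] E →L[ℝ] ℝ) (c e : Finset (Fin n) → E)

theorem continuous_act : Continuous fun x : (Fin n → Fin k → ℝ) × EuclideanSpace ℝ (Fin k) =>
    act x.1 x.2 := by
  unfold act
  fun_prop

theorem continuous_pairVal {X : Type*} [TopologicalSpace X] {f : X → Fin n → Fin k → ℝ}
    {g : X → EuclideanSpace ℝ (Fin k) × EuclideanSpace ℝ (Fin k)} (hf : Continuous f)
    (hg : Continuous g) : Continuous fun x => pairVal B c e (f x) (g x) := by
  have h1 := (continuous_mlin Finset.univ c).comp (continuous_act.comp (hf.prodMk hg.fst))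
  have h2 := (continuous_mlin Finset.univ e).comp (continuous_act.comp (hf.prodMk hg.snd))
  exact (B.continuous.comp h1).clm_apply h2

theorem continuous_pairDeriv {X : Type*} [TopologicalSpace X] {f f' : X → Fin n → Fin k → ℝ}
    {g : X → EuclideanSpace ℝ (Fin k) × EuclideanSpace ℝ (Fin k)} (hf : Continuous f)
    (hf' : Continuous f') (hg : Continuous g) :
    Continuous fun x => pairDeriv B c e (f x) (f' x) (g x) := by
  have h1 := fun i => continuous_pairVal B (partialCoeff i c) e hf hg
  have h2 := fun i => continuous_pairVal B c (partialCoeff i e) hf hg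
  have h3 := fun i => (continuous_apply i).comp (continuous_act.comp (hf'.prodMk hg.fst))
  have h4 := fun i => (continuous_apply i).comp (continuous_act.comp (hf'.prodMk hg.snd))
  exact continuous_finsetSum _ fun i _ => ((h3 i).mul (h1 i)).add ((h4 i).mul (h2 i))

theorem hasDerivAt_act (M M' : Fin n → Fin k → ℝ) (u : EuclideanSpace ℝ (Fin k)) (i : Fin n)
    (θ : ℝ) : HasDerivAt (fun t => act (Real.cos t • M + Real.sin t • M') u i)
      (act (-Real.sin θ • M + Real.cos θ • M') u i) θ := by
  unfold act
  refine HasDerivAt.fun_sum fun j _ => ?_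
  exact (((Real.hasDerivAt_cos θ).mul_const (M i j)).add
    ((Real.hasDerivAt_sin θ).mul_const (M' i j))).mul_const (u j)

theorem hasDerivAt_pairVal (M M' : Fin n → Fin k → ℝ)
    (w : EuclideanSpace ℝ (Fin k) × EuclideanSpace ℝ (Fin k)) (θ : ℝ) :
    HasDerivAt (fun t => pairVal B c e (Real.cos t • M + Real.sin t • M') w)
      (pairDeriv B c e (Real.cos θ • M + Real.sin θ • M')
        (-Real.sin θ • M + Real.cos θ • M') w) θ := by
  have h1 := hasDerivAt_mlin c fun i => hasDerivAt_act M M' w.1 i θ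
  have h2 := hasDerivAt_mlin e fun i => hasDerivAt_act M M' w.2 i θ
  have h3 := (B.hasFDerivAt.comp_hasDerivAt θ h1).clm_apply h2
  refine h3.congr_deriv ?_
  simp only [Function.comp_apply, pairDeriv, pairVal, map_sum, map_smul, FunLike.coe_sum,
    Finset.sum_apply, FunLike.coe_smul, Pi.smul_apply, smul_eq_mul, Finset.sum_add_distrib]

/-- Fundamental theorem of calculus along the quarter circle from `M` at angle 0 to `M'` at angle
`π/2`. -/
theorem pairVal_sub_eq (M M' : Fin n → Fin k → ℝ)
    (w : EuclideanSpace ℝ (Fin k) × EuclideanSpace ℝ (Fin k)) :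
    ∫ θ in (0 : ℝ)..(Real.pi / 2), pairDeriv B c e (Real.cos θ • M + Real.sin θ • M')
        (-Real.sin θ • M + Real.cos θ • M') w
      = pairVal B c e M' w - pairVal B c e M w := by
  rw [intervalIntegral.integral_eq_sub_of_hasDerivAt
    fun θ _ => hasDerivAt_pairVal B c e M M' w θ]
  · simp
  · refine (continuous_pairDeriv B c e ?_ ?_ continuous_const).intervalIntegrable _ _ <;> fun_prop

variable {B}

/-- Cauchy–Schwarz splits the second moment into two fourth moments. Only the separate laws of `M
w.1` and `M w.2` then matter, and each is standard Gaussian. -/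
theorem lintegral_pairVal_sq_le (hB : ∀ x y, |B x y| ≤ ‖x‖ * ‖y‖)
    {w : EuclideanSpace ℝ (Fin k) × EuclideanSpace ℝ (Fin k)} (h1 : ‖w.1‖ = 1)
    (h2 : ‖w.2‖ = 1) :
    ∫⁻ M, ‖pairVal B c e M w‖ₑ ^ 2 ∂gaussMatrix n k
      ≤ ENNReal.ofReal (weight Finset.univ c * weight Finset.univ e) := by
  have hz1 := hasLaw_act (n := n) h1
  have hz2 := hasLaw_act (n := n) h2
  have hc2 : MemLp (fun M => ‖mlin Finset.univ c (act M w.1)‖ ^ 2) 2 (gaussMatrix n k) := by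
    refine (memLp_two_iff_integrable_sq ?_).2 ?_
    · exact (memLp_mlin hz1 Finset.univ c 2).aestronglyMeasurable.norm.pow 2
    · simpa only [← pow_mul] using
        (memLp_mlin hz1 Finset.univ c 4).integrable_norm_pow (by simp)
  have he2 : MemLp (fun M => ‖mlin Finset.univ e (act M w.2)‖ ^ 2) 2 (gaussMatrix n k) := by
    refine (memLp_two_iff_integrable_sq ?_).2 ?_
    · exact (memLp_mlin hz2 Finset.univ e 2).aestronglyMeasurable.norm.pow 2
    · simpa only [← pow_mul] using
        (memLp_mlin hz2 Finset.univ e 4).integrable_norm_pow (by simp)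
  have hint : Integrable (fun M => ‖mlin Finset.univ c (act M w.1)‖ ^ 2
      * ‖mlin Finset.univ e (act M w.2)‖ ^ 2) (gaussMatrix n k) := hc2.integrable_mul he2
  have hle : ∫ M, ‖mlin Finset.univ c (act M w.1)‖ ^ 2 * ‖mlin Finset.univ e (act M w.2)‖ ^ 2
      ∂gaussMatrix n k ≤ weight Finset.univ c * weight Finset.univ e := by
    refine le_of_sq_le_sq ?_ (mul_nonneg (weight_nonneg _ _) (weight_nonneg _ _))
    refine (integral_mul_sq_le hc2 he2).trans ?_
    simp_rw [← pow_mul]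
    rw [mul_pow]
    exact mul_le_mul (integral_norm_mlin_pow_four_le hz1 (iIndepFun_act _) _ c)
      (integral_norm_mlin_pow_four_le hz2 (iIndepFun_act _) _ e)
      (integral_nonneg fun _ => by positivity) (by positivity)
  refine le_trans ?_ (ENNReal.ofReal_le_ofReal hle)
  rw [ofReal_integral_eq_lintegral_ofReal hint (.of_forall fun _ => by positivity)]
  refine lintegral_mono fun M => ?_
  rw [enorm_sq_eq_ofReal]
  refine ENNReal.ofReal_le_ofReal ?_
  rw [← mul_pow, ← sq_abs]
  exact pow_le_pow_left₀ (abs_nonneg _) (hB _ _) 2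

end Pairing

/-! ### Gaussian Poincaré inequality and the variance bound -/

section Variance

variable {n k : ℕ} {E : Type*} [NormedAddCommGroup E] [InnerProductSpace ℝ E]
  {μ : Measure (EuclideanSpace ℝ (Fin k) × EuclideanSpace ℝ (Fin k))}
  [IsProbabilityMeasure μ] {B : E →L[ℝ] E →L[ℝ] ℝ} (c e : Finset (Fin n) → E)

/-- The average of `pairVal` over the pair of vectors. -/
def pairAvg (μ : Measure (EuclideanSpace ℝ (Fin k) × EuclideanSpace ℝ (Fin k)))
    (B : E →L[ℝ] E →L[ℝ] ℝ) (c e : Finset (Fin n) → E) (M : Fin n → Fin k → ℝ) : ℝ :=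
  ∫ w, pairVal B c e M w ∂μ

/-- The average of `pairDeriv` over the pair of vectors. -/
def pairDerivAvg (μ : Measure (EuclideanSpace ℝ (Fin k) × EuclideanSpace ℝ (Fin k)))
    (B : E →L[ℝ] E →L[ℝ] ℝ) (c e : Finset (Fin n) → E) (M M' : Fin n → Fin k → ℝ) : ℝ :=
  ∫ w, pairDeriv B c e M M' w ∂μ

theorem stronglyMeasurable_pairAvg : StronglyMeasurable (pairAvg μ B c e) :=
  StronglyMeasurable.integral_prod_right
    (f := fun (M : Fin n → Fin k → ℝ)
      (w : EuclideanSpace ℝ (Fin k) × EuclideanSpace ℝ (Fin k)) => pairVal B c e M w)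
    (continuous_pairVal B c e continuous_fst continuous_snd).stronglyMeasurable

theorem stronglyMeasurable_pairDerivAvg :
    StronglyMeasurable fun x : (Fin n → Fin k → ℝ) × (Fin n → Fin k → ℝ) =>
      pairDerivAvg μ B c e x.1 x.2 :=
  StronglyMeasurable.integral_prod_right
    (f := fun (x : (Fin n → Fin k → ℝ) × (Fin n → Fin k → ℝ))
      (w : EuclideanSpace ℝ (Fin k) × EuclideanSpace ℝ (Fin k)) => pairDeriv B c e x.1 x.2 w)
    (continuous_pairDeriv B c e continuous_fst.fst continuous_fst.snd
      continuous_snd).stronglyMeasurable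

theorem pairAvg_sub_eq (hμ : IsSphericalPair μ) (M M' : Fin n → Fin k → ℝ) :
    pairAvg μ B c e M' - pairAvg μ B c e M
      = ∫ θ in (0 : ℝ)..(Real.pi / 2), pairDerivAvg μ B c e (Real.cos θ • M + Real.sin θ • M')
        (-Real.sin θ • M + Real.cos θ • M') := by
  unfold pairDerivAvg
  rw [intervalIntegral_integral_swap]
  · simp_rw [pairVal_sub_eq]
    rw [integral_sub]
    · rfl
    all_goals exact hμ.integrable (continuous_pairVal B c e continuous_const continuous_id)
  · refine hμ.integrable_interval (f := fun x => pairDeriv B c e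
      (Real.cos x.1 • M + Real.sin x.1 • M') (-Real.sin x.1 • M + Real.cos x.1 • M') x.2) ?_
    refine continuous_pairDeriv B c e ?_ ?_ continuous_snd <;> fun_prop

/-- Two independent copies of a centred Gaussian are jointly invariant under rotation. -/
theorem measurePreserving_rotation (θ : ℝ) :
    MeasurePreserving (ContinuousLinearMap.rotation (E := Fin n → Fin k → ℝ) θ)
      ((gaussMatrix n k).prod (gaussMatrix n k)) ((gaussMatrix n k).prod (gaussMatrix n k)) := by
  refine ⟨by fun_prop, IsGaussian.map_rotation_eq_self_of_forall_strongDual_eq_zero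
    integral_strongDual_gaussMatrix θ⟩

/-- A Gaussian Poincaré inequality. -/
theorem lintegral_pairAvg_sub_sq_le (hμ : IsSphericalPair μ) :
    ∫⁻ x, ‖pairAvg μ B c e x.2 - pairAvg μ B c e x.1‖ₑ ^ 2
        ∂(gaussMatrix n k).prod (gaussMatrix n k)
      ≤ ENNReal.ofReal (Real.pi / 2) ^ 2 * ∫⁻ x, ‖pairDerivAvg μ B c e x.1 x.2‖ₑ ^ 2
        ∂(gaussMatrix n k).prod (gaussMatrix n k) := by
  have hpi : 0 ≤ Real.pi / 2 := by positivity
  set ν := volume.restrict (Set.Ioc 0 (Real.pi / 2))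
  have hν : ν Set.univ = ENNReal.ofReal (Real.pi / 2) := by simp [ν]
  set Γ := (gaussMatrix n k).prod (gaussMatrix n k)
  let r : ℝ → (Fin n → Fin k → ℝ) × (Fin n → Fin k → ℝ) →
      (Fin n → Fin k → ℝ) × (Fin n → Fin k → ℝ) := fun θ x => ContinuousLinearMap.rotation θ x
  have hr : Continuous (Function.uncurry r) := by
    simp only [r, Function.uncurry_def, ContinuousLinearMap.rotation_apply]
    fun_prop
  let K : (Fin n → Fin k → ℝ) × (Fin n → Fin k → ℝ) → ℝ :=
    fun x => pairDerivAvg μ B c e x.1 x.2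
  have hK : StronglyMeasurable K := stronglyMeasurable_pairDerivAvg c e
  have hKr : Measurable fun p : ℝ × ((Fin n → Fin k → ℝ) × (Fin n → Fin k → ℝ)) =>
      ‖K (r p.1 p.2)‖ₑ ^ 2 :=
    ((hK.comp_measurable hr.measurable).measurable.enorm.pow_const 2)
  -- Cauchy–Schwarz in the angle costs one factor `π/2`. The second comes from integrating over the
  -- angle an energy that rotation invariance makes constant.
  have h1 : ∀ x : (Fin n → Fin k → ℝ) × (Fin n → Fin k → ℝ),
      ‖pairAvg μ B c e x.2 - pairAvg μ B c e x.1‖ₑ ^ 2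
        ≤ ENNReal.ofReal (Real.pi / 2) * ∫⁻ θ, ‖K (r θ x)‖ₑ ^ 2 ∂ν := by
    intro x
    rw [pairAvg_sub_eq c e hμ, intervalIntegral.integral_of_le hpi, ← hν]
    have := enorm_integral_sq_le (ν := ν) (f := fun θ => K (r θ x))
      (hK.comp_measurable (hr.comp (by fun_prop : Continuous fun θ : ℝ =>
        (θ, x))).measurable).aestronglyMeasurable
    simpa only [K, r, ContinuousLinearMap.rotation_apply] using this
  refine (lintegral_mono h1).trans ?_
  rw [lintegral_const_mul' _ _ ENNReal.ofReal_ne_top, lintegral_lintegral_swap]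
  · have h2 : ∀ θ, ∫⁻ x, ‖K (r θ x)‖ₑ ^ 2 ∂Γ = ∫⁻ x, ‖K x‖ₑ ^ 2 ∂Γ := fun θ =>
      (measurePreserving_rotation θ).lintegral_comp (hK.measurable.enorm.pow_const 2)
    simp_rw [h2]
    rw [lintegral_const, hν, sq, mul_assoc, mul_comm (lintegral _ _)]
  · exact (hKr.comp measurable_swap).aemeasurable

/-- This is where the dimension is gained. For fixed `M` the averaged derivative is a linear form in
`M'`, so its second moment is the sum of its squared coefficients. Those are correlations with
coordinates of isotropic vectors, and Bessel gives the factor `1/k`; the 2 comes from `(a + b)² ≤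
2a² + 2b²`. -/
theorem lintegral_pairDerivAvg_sq_le (hμ : IsSphericalPair μ) (M : Fin n → Fin k → ℝ) :
    ∫⁻ M', ‖pairDerivAvg μ B c e M M'‖ₑ ^ 2 ∂gaussMatrix n k
      ≤ ∑ i, (ENNReal.ofReal (2 / k) * ∫⁻ w, ‖pairVal B (partialCoeff i c) e M w‖ₑ ^ 2 ∂μ
        + ENNReal.ofReal (2 / k) * ∫⁻ w, ‖pairVal B c (partialCoeff i e) M w‖ₑ ^ 2 ∂μ) := by
  set f : Fin n → EuclideanSpace ℝ (Fin k) × EuclideanSpace ℝ (Fin k) → ℝ :=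
    fun i => pairVal B (partialCoeff i c) e M with hf
  set g : Fin n → EuclideanSpace ℝ (Fin k) × EuclideanSpace ℝ (Fin k) → ℝ :=
    fun i => pairVal B c (partialCoeff i e) M with hg
  have hfc : ∀ i, Continuous (f i) := fun i =>
    continuous_pairVal B _ _ continuous_const continuous_id
  have hgc : ∀ i, Continuous (g i) := fun i =>
    continuous_pairVal B _ _ continuous_const continuous_id
  set α : Fin n → Fin k → ℝ := fun i j => ∫ w, w.1 j * f i w ∂μ with hα
  set β : Fin n → Fin k → ℝ := fun i j => ∫ w, w.2 j * g i w ∂μ with hβ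
  have h1 : ∀ M', pairDerivAvg μ B c e M M' = ∑ i, ∑ j, M' i j * (α i j + β i j) := by
    intro M'
    have h2 : ∀ w, pairDeriv B c e M M' w
        = ∑ i, ∑ j, M' i j * (w.1 j * f i w + w.2 j * g i w) := by
      intro w
      unfold pairDeriv act
      refine Finset.sum_congr rfl fun i _ => ?_
      rw [Finset.sum_mul, Finset.sum_mul, ← Finset.sum_add_distrib]
      refine Finset.sum_congr rfl fun j _ => ?_
      simp only [hf, hg]
      ring
    unfold pairDerivAvg
    simp_rw [h2]
    have hi1 : ∀ i j, Integrable (fun w => w.1 j * f i w) μ := fun i j =>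
      hμ.integrable (by have := hfc i; fun_prop)
    have hi2 : ∀ i j, Integrable (fun w => w.2 j * g i w) μ := fun i j =>
      hμ.integrable (by have := hgc i; fun_prop)
    have hi : ∀ i j, Integrable (fun w => M' i j * (w.1 j * f i w + w.2 j * g i w)) μ :=
      fun i j => ((hi1 i j).add (hi2 i j)).const_mul _
    rw [integral_finsetSum _ fun i _ => integrable_finsetSum _ fun j _ => hi i j]
    refine Finset.sum_congr rfl fun i _ => ?_
    rw [integral_finsetSum _ fun j _ => hi i j]
    refine Finset.sum_congr rfl fun j _ => ?_
    rw [integral_const_mul, integral_add (hi1 i j) (hi2 i j)]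
  simp_rw [h1]
  rw [integral_sq_eq_of_lintegral, integral_linearForm_sq]
  · have h3 : ∀ i, ∑ j, (α i j + β i j) ^ 2
        ≤ 2 / k * ∫ w, f i w ^ 2 ∂μ + 2 / k * ∫ w, g i w ^ 2 ∂μ := by
      intro i
      have hA := sum_integral_coord_mul_sq_le hμ continuous_fst hμ.isotropic_fst (hfc i)
      have hB := sum_integral_coord_mul_sq_le hμ continuous_snd hμ.isotropic_snd (hgc i)
      have hC : ∑ j, (α i j + β i j) ^ 2 ≤ 2 * ∑ j, α i j ^ 2 + 2 * ∑ j, β i j ^ 2 := by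
        rw [Finset.mul_sum, Finset.mul_sum, ← Finset.sum_add_distrib]
        exact Finset.sum_le_sum fun j _ => by nlinarith [sq_nonneg (α i j - β i j)]
      refine hC.trans ?_
      rw [div_mul_eq_mul_div, div_mul_eq_mul_div, mul_div_assoc, mul_div_assoc]
      linarith
    refine (ENNReal.ofReal_le_ofReal (Finset.sum_le_sum fun i _ => h3 i)).trans_eq ?_
    have hp : ∀ i, 0 ≤ 2 / (k : ℝ) * ∫ w, f i w ^ 2 ∂μ := fun i =>
      mul_nonneg (by positivity) (integral_nonneg fun _ => sq_nonneg _)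
    have hq : ∀ i, 0 ≤ 2 / (k : ℝ) * ∫ w, g i w ^ 2 ∂μ := fun i =>
      mul_nonneg (by positivity) (integral_nonneg fun _ => sq_nonneg _)
    rw [ENNReal.ofReal_sum_of_nonneg fun i _ => add_nonneg (hp i) (hq i)]
    refine Finset.sum_congr rfl fun i _ => ?_
    rw [ENNReal.ofReal_add (hp i) (hq i), ENNReal.ofReal_mul (by positivity),
      ENNReal.ofReal_mul (by positivity), integral_sq_eq_of_lintegral (hμ.memLp (hfc i)),
      integral_sq_eq_of_lintegral (hμ.memLp (hgc i))]
  · exact memLp_linearForm fun i j => α i j + β i j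

theorem lintegral_lintegral_pairVal_sq_le (hB : ∀ x y, |B x y| ≤ ‖x‖ * ‖y‖)
    (hμ : IsSphericalPair μ) :
    ∫⁻ M, ∫⁻ w, ‖pairVal B c e M w‖ₑ ^ 2 ∂μ ∂gaussMatrix n k
      ≤ ENNReal.ofReal (weight Finset.univ c * weight Finset.univ e) := by
  rw [lintegral_lintegral_swap]
  · have h : ∀ᵐ w ∂μ, ∫⁻ M, ‖pairVal B c e M w‖ₑ ^ 2 ∂gaussMatrix n k
        ≤ ENNReal.ofReal (weight Finset.univ c * weight Finset.univ e) := by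
      filter_upwards [hμ.norm_fst, hμ.norm_snd] with w h1 h2
      exact lintegral_pairVal_sq_le c e hB h1 h2
    refine (lintegral_mono_ae h).trans ?_
    simp
  · exact ((continuous_pairVal B c e continuous_fst
      continuous_snd).measurable.enorm.pow_const 2).aemeasurable

/-- The constant is the product of `5/2 ≥ (π/2)²`, the Bessel factor `2/k`, and `2 d 9^d` from the
weights of the polynomials and their derivatives. -/
theorem lintegral_pairAvg_sub_sq_le' (hB : ∀ x y, |B x y| ≤ ‖x‖ * ‖y‖)
    (hμ : IsSphericalPair μ) {d : ℕ} (hc : ∀ S, d < S.card → c S = 0)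
    (he : ∀ S, d < S.card → e S = 0) (hc1 : ∑ S, ‖c S‖ ^ 2 ≤ 1) (he1 : ∑ S, ‖e S‖ ^ 2 ≤ 1) :
    ∫⁻ x, ‖pairAvg μ B c e x.2 - pairAvg μ B c e x.1‖ₑ ^ 2
        ∂(gaussMatrix n k).prod (gaussMatrix n k)
      ≤ ENNReal.ofReal (10 * d * 9 ^ d / k) := by
  refine (lintegral_pairAvg_sub_sq_le c e hμ).trans ?_
  rw [lintegral_prod _ ((stronglyMeasurable_pairDerivAvg c e).measurable.enorm.pow_const
    2).aemeasurable]
  have hmeas : ∀ c' e' : Finset (Fin n) → E, Measurable fun M : Fin n → Fin k → ℝ =>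
      ∫⁻ w, ‖pairVal B c' e' M w‖ₑ ^ 2 ∂μ := fun c' e' =>
    Measurable.lintegral_prod_right' (f := fun x => ‖pairVal B c' e' x.1 x.2‖ₑ ^ 2)
      ((continuous_pairVal B c' e' continuous_fst continuous_snd).measurable.enorm.pow_const 2)
  have h1 : ∫⁻ M, ∫⁻ M', ‖pairDerivAvg μ B c e M M'‖ₑ ^ 2 ∂gaussMatrix n k ∂gaussMatrix n k
      ≤ ∑ i, (ENNReal.ofReal (2 / k) * ENNReal.ofReal
          (weight Finset.univ (partialCoeff i c) * weight Finset.univ e)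
        + ENNReal.ofReal (2 / k) * ENNReal.ofReal
          (weight Finset.univ c * weight Finset.univ (partialCoeff i e))) := by
    refine (lintegral_mono fun M => lintegral_pairDerivAvg_sq_le c e hμ M).trans ?_
    rw [lintegral_finsetSum]
    swap
    · exact fun i _ => ((hmeas _ _).const_mul _).add ((hmeas _ _).const_mul _)
    refine Finset.sum_le_sum fun i _ => ?_
    rw [lintegral_add_left ((hmeas _ _).const_mul _), lintegral_const_mul _ (hmeas _ _),
      lintegral_const_mul _ (hmeas _ _)]
    gcongr
    · exact lintegral_lintegral_pairVal_sq_le _ _ hB hμ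
    · exact lintegral_lintegral_pairVal_sq_le _ _ hB hμ
  have hW := fun (c' : Finset (Fin n) → E) => weight_nonneg Finset.univ c'
  have h2 : ∑ i, (ENNReal.ofReal (2 / k) * ENNReal.ofReal
          (weight Finset.univ (partialCoeff i c) * weight Finset.univ e)
        + ENNReal.ofReal (2 / k) * ENNReal.ofReal
          (weight Finset.univ c * weight Finset.univ (partialCoeff i e)))
      = ENNReal.ofReal (2 / k * ((∑ i, weight Finset.univ (partialCoeff i c))
        * weight Finset.univ e
        + weight Finset.univ c * ∑ i, weight Finset.univ (partialCoeff i e))) := by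
    rw [Finset.sum_mul, Finset.mul_sum, ← Finset.sum_add_distrib, Finset.mul_sum,
      ENNReal.ofReal_sum_of_nonneg]
    · refine Finset.sum_congr rfl fun i _ => ?_
      have h0 : (0 : ℝ) ≤ 2 / k := by positivity
      rw [mul_add, ENNReal.ofReal_add, ENNReal.ofReal_mul h0, ENNReal.ofReal_mul h0]
      · exact mul_nonneg (by positivity) (mul_nonneg (hW _) (hW _))
      · exact mul_nonneg (by positivity) (mul_nonneg (hW _) (hW _))
    · exact fun i _ => mul_nonneg (by positivity)
        (add_nonneg (mul_nonneg (hW _) (hW _)) (mul_nonneg (hW _) (hW _)))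
  refine (mul_le_mul_right (h1.trans_eq h2) _).trans ?_
  rw [← ENNReal.ofReal_pow (by positivity), ← ENNReal.ofReal_mul (by positivity)]
  refine ENNReal.ofReal_le_ofReal ?_
  have hcW : weight Finset.univ c ≤ 3 ^ d := (weight_le c hc).trans
    (mul_le_of_le_one_right (by positivity) hc1)
  have heW : weight Finset.univ e ≤ 3 ^ d := (weight_le e he).trans
    (mul_le_of_le_one_right (by positivity) he1)
  have hcD : ∑ i, weight Finset.univ (partialCoeff i c) ≤ d * 3 ^ d :=
    (sum_weight_partialCoeff_le c hc).trans (mul_le_of_le_one_right (by positivity) hc1)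
  have heD : ∑ i, weight Finset.univ (partialCoeff i e) ≤ d * 3 ^ d :=
    (sum_weight_partialCoeff_le e he).trans (mul_le_of_le_one_right (by positivity) he1)
  have h9 : (9 : ℝ) ^ d = 3 ^ d * 3 ^ d := by rw [← mul_pow]; norm_num
  have hsum : (∑ i, weight Finset.univ (partialCoeff i c)) * weight Finset.univ e
      + weight Finset.univ c * ∑ i, weight Finset.univ (partialCoeff i e)
      ≤ 2 * d * 9 ^ d := by
    have hA := mul_le_mul hcD heW (hW _) (by positivity)
    have hB := mul_le_mul hcW heD (Finset.sum_nonneg fun i _ => hW _) (by positivity)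
    rw [h9]
    linarith
  have hpi : (Real.pi / 2) ^ 2 ≤ 5 / 2 := by
    have := Real.pi_lt_d2
    have := Real.pi_pos
    nlinarith
  have hfin := mul_le_mul hpi (mul_le_mul_of_nonneg_left hsum
    (by positivity : (0 : ℝ) ≤ 2 / k)) (mul_nonneg (by positivity) (add_nonneg
      (mul_nonneg (Finset.sum_nonneg fun i _ => hW _) (hW _))
      (mul_nonneg (hW _) (Finset.sum_nonneg fun i _ => hW _)))) (by norm_num)
  refine hfin.trans_eq ?_
  ring

end Variance

/-! ### Mean and concentration of the averaged pairing -/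

section Deviation

variable {n k : ℕ} {E : Type*} [NormedAddCommGroup E] [InnerProductSpace ℝ E]
  {μ : Measure (EuclideanSpace ℝ (Fin k) × EuclideanSpace ℝ (Fin k))}
  [IsProbabilityMeasure μ] {B : E →L[ℝ] E →L[ℝ] ℝ} (c e : Finset (Fin n) → E)

theorem integrable_pairVal (hB : ∀ x y, |B x y| ≤ ‖x‖ * ‖y‖) (hμ : IsSphericalPair μ) :
    Integrable (fun x : (Fin n → Fin k → ℝ) × _ => pairVal B c e x.1 x.2)
      ((gaussMatrix n k).prod μ) := by
  have hcont := continuous_pairVal (n := n) (k := k) B c e continuous_fst continuous_snd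
  refine MemLp.integrable one_le_two
    ((memLp_two_iff_integrable_sq hcont.aestronglyMeasurable).2
      ⟨(hcont.pow 2).aestronglyMeasurable, ?_⟩)
  rw [HasFiniteIntegral]
  simp_rw [enorm_pow]
  rw [lintegral_prod _ (hcont.measurable.enorm.pow_const 2).aemeasurable]
  exact (lintegral_lintegral_pairVal_sq_le c e hB hμ).trans_lt ENNReal.ofReal_lt_top

/-- The mean of a bilinear form at two multilinear polynomials whose monomials are
biorthogonal. -/
theorem integral_bilin_mlin {Ω : Type*} [MeasurableSpace Ω] {P : Measure Ω}
    {X Y : Ω → Fin n → ℝ} {r : ℝ} (B : E →L[ℝ] E →L[ℝ] ℝ)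
    (hX : ∀ S, MemLp (fun ω => ∏ i ∈ S, X ω i) 2 P) (hY : ∀ S, MemLp (fun ω => ∏ i ∈ S, Y ω i) 2 P)
    (hXY : ∀ S T, ∫ ω, (∏ i ∈ S, X ω i) * ∏ i ∈ T, Y ω i ∂P = if S = T then r ^ S.card else 0) :
    ∫ ω, B (mlin Finset.univ c (X ω)) (mlin Finset.univ e (Y ω)) ∂P
      = ∑ S, r ^ S.card * B (c S) (e S) := by
  have h3 : ∀ ω, B (mlin Finset.univ c (X ω)) (mlin Finset.univ e (Y ω))
      = ∑ S, ∑ T, ((∏ i ∈ S, X ω i) * ∏ i ∈ T, Y ω i) * B (c S) (e T) := by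
    intro ω
    simp only [mlin, map_sum, map_smul, FunLike.coe_sum, Finset.sum_apply,
      FunLike.coe_smul, Pi.smul_apply, smul_eq_mul, Finset.powerset_univ]
    rw [Finset.sum_comm]
    refine Finset.sum_congr rfl fun S _ => ?_
    simp only [Finset.mul_sum]
    exact Finset.sum_congr rfl fun T _ => by ring
  simp_rw [h3]
  have hi : ∀ S T : Finset (Fin n), Integrable (fun ω =>
      ((∏ i ∈ S, X ω i) * ∏ i ∈ T, Y ω i) * B (c S) (e T)) P :=
    fun S T => ((hX S).integrable_mul (hY T)).mul_const _
  rw [integral_finsetSum _ fun S _ => integrable_finsetSum _ fun T _ => hi S T]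
  refine Finset.sum_congr rfl fun S _ => ?_
  rw [integral_finsetSum _ fun T _ => hi S T]
  simp_rw [integral_mul_const, hXY]
  simp

theorem integral_pairVal {w : EuclideanSpace ℝ (Fin k) × EuclideanSpace ℝ (Fin k)}
    (h1 : ‖w.1‖ = 1) (h2 : ‖w.2‖ = 1) :
    ∫ M, pairVal B c e M w ∂gaussMatrix n k
      = ∑ S, inner ℝ w.1 w.2 ^ S.card * B (c S) (e S) :=
  integral_bilin_mlin c e B (fun S => memLp_prod (hasLaw_act h1) S 2)
    (fun S => memLp_prod (hasLaw_act h2) S 2) (integral_prod_act_mul_prod_act w.1 w.2)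

theorem integrable_pairAvg (hB : ∀ x y, |B x y| ≤ ‖x‖ * ‖y‖) (hμ : IsSphericalPair μ) :
    Integrable (pairAvg μ B c e) (gaussMatrix n k) :=
  (integrable_pairVal c e hB hμ).integral_prod_left

/-- By Fubini and orthogonality of monomials, the law of the pair enters only through the moments of
the inner product. -/
theorem integral_pairAvg (hB : ∀ x y, |B x y| ≤ ‖x‖ * ‖y‖) (hμ : IsSphericalPair μ) :
    ∫ M, pairAvg μ B c e M ∂gaussMatrix n k
      = ∑ S, (∫ w, inner ℝ w.1 w.2 ^ S.card ∂μ) * B (c S) (e S) := by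
  unfold pairAvg
  rw [integral_integral_swap (integrable_pairVal c e hB hμ)]
  have h : ∀ᵐ w ∂μ, ∫ M, pairVal B c e M w ∂gaussMatrix n k
      = ∑ S, inner ℝ w.1 w.2 ^ S.card * B (c S) (e S) := by
    filter_upwards [hμ.norm_fst, hμ.norm_snd] with w h1 h2 using integral_pairVal c e h1 h2
  rw [integral_congr_ae h, integral_finsetSum _ fun S _ => hμ.integrable (by fun_prop)]
  simp_rw [integral_mul_const]

theorem measure_pairAvg_deviation_le (hB : ∀ x y, |B x y| ≤ ‖x‖ * ‖y‖)
    (hμ : IsSphericalPair μ) {d : ℕ} (hc : ∀ S, d < S.card → c S = 0)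
    (he : ∀ S, d < S.card → e S = 0) (hc1 : ∑ S, ‖c S‖ ^ 2 ≤ 1) (he1 : ∑ S, ‖e S‖ ^ 2 ≤ 1)
    {ε : ℝ} (hε : 0 < ε) :
    (gaussMatrix n k).real
        {M | ε ≤ |pairAvg μ B c e M - ∫ M', pairAvg μ B c e M' ∂gaussMatrix n k|}
      ≤ 10 * d * 9 ^ d / k / ε ^ 2 := by
  set G := pairAvg μ B c e with hG
  have hGi : Integrable G (gaussMatrix n k) := integrable_pairAvg c e hB hμ
  have hGm : StronglyMeasurable G := stronglyMeasurable_pairAvg c e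
  set m := ∫ M', G M' ∂gaussMatrix n k with hm
  -- The mean is an average over an independent copy, so Jensen bounds the variance by the two-copy
  -- difference; Chebyshev follows.
  have h1 : ∀ M, ‖G M - m‖ₑ ^ 2 ≤ ∫⁻ M', ‖G M' - G M‖ₑ ^ 2 ∂gaussMatrix n k := by
    intro M
    have h2 : ∫ M', (G M' - G M) ∂gaussMatrix n k = m - G M := by
      rw [integral_sub hGi (integrable_const _), integral_const, probReal_univ, one_smul]
    have h3 := enorm_integral_sq_le (ν := gaussMatrix n k) (f := fun M' => G M' - G M)
      (hGi.sub (integrable_const _)).aestronglyMeasurable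
    rwa [h2, measure_univ, one_mul, ← enorm_neg, neg_sub] at h3
  have h4 : ∫⁻ M, ‖G M - m‖ₑ ^ 2 ∂gaussMatrix n k ≤ ENNReal.ofReal (10 * d * 9 ^ d / k) := by
    refine (lintegral_mono h1).trans (le_trans (le_of_eq ?_)
      (lintegral_pairAvg_sub_sq_le' c e hB hμ hc he hc1 he1))
    rw [lintegral_prod]
    refine (Measurable.aemeasurable ?_)
    exact ((hGm.measurable.comp measurable_snd).sub
      (hGm.measurable.comp measurable_fst)).enorm.pow_const 2
  have h5 := mul_meas_ge_le_lintegral₀ (μ := gaussMatrix n k) (f := fun M => ‖G M - m‖ₑ ^ 2)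
    ((hGm.measurable.sub_const m).enorm.pow_const 2).aemeasurable (ENNReal.ofReal (ε ^ 2))
  have h6 : {M | ε ≤ |G M - m|} = {M | ENNReal.ofReal (ε ^ 2) ≤ ‖G M - m‖ₑ ^ 2} := by
    ext M
    simp only [Set.mem_ofPred_eq, enorm_sq_eq_ofReal]
    rw [ENNReal.ofReal_le_ofReal_iff (sq_nonneg _), sq_le_sq, abs_of_pos hε]
  rw [← h6] at h5
  have h7 := ENNReal.toReal_mono ENNReal.ofReal_ne_top (h5.trans h4)
  rw [ENNReal.toReal_mul, ENNReal.toReal_ofReal (by positivity),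
    ENNReal.toReal_ofReal (by positivity)] at h7
  rw [le_div_iff₀ (by positivity), mul_comm]
  exact h7

end Deviation

/-! ### Normalized Gaussian vectors -/

section UnitVector

variable {N : ℕ}

/-- The normalization of a vector. -/
def unitVec (x : EuclideanSpace ℝ (Fin N)) : EuclideanSpace ℝ (Fin N) := ‖x‖⁻¹ • x

theorem measurable_unitVec : Measurable (unitVec (N := N)) :=
  measurable_norm.inv.smul measurable_id

theorem norm_unitVec {x : EuclideanSpace ℝ (Fin N)} (hx : x ≠ 0) : ‖unitVec x‖ = 1 :=
  norm_smul_inv_norm hx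

theorem norm_unitVec_le (x : EuclideanSpace ℝ (Fin N)) : ‖unitVec x‖ ≤ 1 := by
  rcases eq_or_ne x 0 with rfl | hx
  · simp [unitVec]
  · exact (norm_unitVec hx).le

theorem measurePreserving_toLp :
    MeasurePreserving (WithLp.toLp 2) (gaussPi (Fin N)) (gauss N) :=
  ⟨by fun_prop, map_pi_eq_stdGaussian⟩

theorem ae_ne_zero_gauss (hN : 0 < N) : ∀ᵐ x ∂gauss N, x ≠ 0 := by
  rw [← measurePreserving_toLp.map_eq]
  rw [ae_map_iff (p := fun x : EuclideanSpace ℝ (Fin N) => x ≠ 0) (by fun_prop)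
    (measurableSet_singleton 0).compl]
  have h := (measurePreserving_eval (fun _ : Fin N => gaussianReal 0 1) ⟨0, hN⟩).quasiMeasurePreserving.ae
    (p := fun x => x ≠ 0) (by
      have := nullSingletonClass_gaussianReal (μ := 0) (v := 1) one_ne_zero
      exact Measure.ae_ne _ _)
  filter_upwards [h] with x hx h0
  refine hx ?_
  have := congrArg (fun y : EuclideanSpace ℝ (Fin N) => y ⟨0, hN⟩) h0
  simpa using this

/-- Rotation invariance makes the integral depend only on `‖a‖`, so all coordinates have the same
second moment. These sum to 1. -/
theorem integral_inner_unitVec_sq (hN : 0 < N) (a : EuclideanSpace ℝ (Fin N)) :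
    ∫ x, inner ℝ a (unitVec x) ^ 2 ∂gauss N = ‖a‖ ^ 2 / N := by
  have hint : ∀ b, Integrable (fun x => inner ℝ b (unitVec x) ^ 2) (gauss N) := by
    intro b
    refine Integrable.of_bound (C := ‖b‖ ^ 2) ?_ (.of_forall fun x => ?_)
    · have := measurable_unitVec (N := N)
      exact Measurable.aestronglyMeasurable (by fun_prop)
    · rw [norm_pow]
      gcongr
      exact (norm_inner_le_norm _ _).trans (mul_le_of_le_one_right (norm_nonneg _)
        (norm_unitVec_le _))
  have hrot : ∀ b b' : EuclideanSpace ℝ (Fin N), ‖b‖ = ‖b'‖ →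
      ∫ x, inner ℝ b (unitVec x) ^ 2 ∂gauss N = ∫ x, inner ℝ b' (unitVec x) ^ 2 ∂gauss N := by
    intro b b' h
    -- For vectors of equal norm, the reflection in the hyperplane orthogonal to `b - b'` sends `b`
    -- to `b'`.
    set R := (Submodule.reflection (ℝ ∙ (b - b'))ᗮ) with hR
    have h1 : R b = b' := Submodule.reflection_sub h
    have h2 : (gauss N).map R = gauss N := stdGaussian_map R
    conv_rhs => rw [← h2]
    rw [integral_map R.continuous.aemeasurable
      (by have := measurable_unitVec (N := N); exact Measurable.aestronglyMeasurable (by fun_prop))]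
    refine integral_congr_ae (.of_forall fun x => ?_)
    have h3 : unitVec (R x) = R (unitVec x) := by
      simp [unitVec]
    simp only [h3, ← h1, LinearIsometryEquiv.inner_map_map]
  have hbasis : ∀ j, ∫ x, inner ℝ a (unitVec x) ^ 2 ∂gauss N
      = ‖a‖ ^ 2 * ∫ x, (unitVec x j) ^ 2 ∂gauss N := by
    intro j
    rw [hrot a (‖a‖ • EuclideanSpace.single j 1) (by simp [norm_smul]), ← integral_const_mul]
    refine integral_congr_ae (.of_forall fun x => ?_)
    simp [real_inner_smul_left, EuclideanSpace.inner_single_left, mul_pow]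
  have hsum : (N : ℝ) * ∫ x, inner ℝ a (unitVec x) ^ 2 ∂gauss N = ‖a‖ ^ 2 := by
    have h1 : ∑ _j : Fin N, ∫ x, inner ℝ a (unitVec x) ^ 2 ∂gauss N
        = ∑ j, ‖a‖ ^ 2 * ∫ x, (unitVec x j) ^ 2 ∂gauss N :=
      Finset.sum_congr rfl fun j _ => hbasis j
    rw [Finset.sum_const, Finset.card_univ, Fintype.card_fin, nsmul_eq_mul, ← Finset.mul_sum,
      ← integral_finsetSum] at h1
    · rw [h1]
      have h2 : ∀ᵐ x ∂gauss N, ∑ j, unitVec x j ^ 2 = 1 := by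
        filter_upwards [ae_ne_zero_gauss hN] with x hx
        rw [← EuclideanSpace.real_norm_sq_eq, norm_unitVec hx, one_pow]
      rw [integral_congr_ae h2]
      simp
    · intro j _
      simpa [EuclideanSpace.inner_single_left] using hint (EuclideanSpace.single j 1)
  have hN' : (N : ℝ) ≠ 0 := by positivity
  rw [← hsum, mul_div_cancel_left₀ _ hN']

/-- A pair of measurable maps with Gaussian laws yields a spherical pair by normalization. -/
theorem isSphericalPair_map {Ω : Type*} [MeasurableSpace Ω] {P : Measure Ω} (hN : 0 < N)
    {X Y : Ω → EuclideanSpace ℝ (Fin N)} (hX : MeasurePreserving X P (gauss N))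
    (hY : MeasurePreserving Y P (gauss N)) :
    IsSphericalPair (P.map fun ω => (unitVec (X ω), unitVec (Y ω))) := by
  have hmX : Measurable fun ω => unitVec (X ω) := measurable_unitVec.comp hX.measurable
  have hmY : Measurable fun ω => unitVec (Y ω) := measurable_unitVec.comp hY.measurable
  have hm : AEMeasurable (fun ω => (unitVec (X ω), unitVec (Y ω))) P :=
    (hmX.prodMk hmY).aemeasurable
  constructor
  · rw [ae_map_iff hm (measurableSet_eq_fun (by fun_prop) (by fun_prop))]
    exact (hX.quasiMeasurePreserving.ae (ae_ne_zero_gauss hN)).mono fun ω h => norm_unitVec h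
  · rw [ae_map_iff hm (measurableSet_eq_fun (by fun_prop) (by fun_prop))]
    exact (hY.quasiMeasurePreserving.ae (ae_ne_zero_gauss hN)).mono fun ω h => norm_unitVec h
  · intro a
    rw [integral_map hm (by fun_prop), ← integral_inner_unitVec_sq hN a, ← hX.map_eq,
      integral_map hX.aemeasurable]
    have := measurable_unitVec (N := N)
    exact Measurable.aestronglyMeasurable (by fun_prop)
  · intro a
    rw [integral_map hm (by fun_prop), ← integral_inner_unitVec_sq hN a, ← hY.map_eq,
      integral_map hY.aemeasurable]
    have := measurable_unitVec (N := N)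
    exact Measurable.aestronglyMeasurable (by fun_prop)

end UnitVector

/-! ### Correlated Gaussian pairs and empirical averages -/

section Correlated

variable {N : ℕ} {ρ : ℝ}

theorem posSemidef_corr (hρ : |ρ| ≤ 1) : (!![1, ρ; ρ, 1] : Matrix (Fin 2) (Fin 2) ℝ).PosSemidef := by
  refine Matrix.PosSemidef.of_dotProduct_mulVec_nonneg ?_ fun x => ?_
  · ext i j
    fin_cases i <;> fin_cases j <;> simp
  · have := abs_le.1 hρ
    simp [Matrix.mulVec, dotProduct, Fin.sum_univ_two]
    nlinarith [mul_nonneg (sub_nonneg.2 this.2) (add_nonneg (sq_nonneg (x 0)) (sq_nonneg (x 1))),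
      mul_nonneg (by linarith : 0 ≤ 1 + ρ) (sq_nonneg (x 0 + x 1)),
      mul_nonneg (sub_nonneg.2 this.2) (sq_nonneg (x 0 - x 1))]

/-- The law of one pair of `ρ`-correlated standard Gaussians. -/
abbrev corrPair (ρ : ℝ) : Measure (EuclideanSpace ℝ (Fin 2)) :=
  multivariateGaussian 0 !![1, ρ; ρ, 1]

theorem measurePreserving_corrPair (hρ : |ρ| ≤ 1) (k : Fin 2) :
    MeasurePreserving (fun p : EuclideanSpace ℝ (Fin 2) => p k) (corrPair ρ) (gaussianReal 0 1) := by
  have h := measurePreserving_eval_multivariateGaussian (μ := 0) (posSemidef_corr hρ) (i := k)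
  fin_cases k <;> simpa using h

instance : IsProbabilityMeasure (corrGauss ρ N) := by
  unfold corrGauss
  infer_instance

theorem measurePreserving_coords (hρ : |ρ| ≤ 1) (k : Fin 2) :
    MeasurePreserving (coords (n := N) k) (corrGauss ρ N) (gauss N) :=
  measurePreserving_toLp.comp
    (measurePreserving_pi _ _ fun _ : Fin N => measurePreserving_corrPair hρ k)

theorem memLp_corrPair (hρ : |ρ| ≤ 1) (k : Fin 2) :
    MemLp (fun p : EuclideanSpace ℝ (Fin 2) => p k) 2 (corrPair ρ) :=
  memLp_of_hasLaw_gaussianReal (measurePreserving_corrPair hρ k).hasLaw (by simp)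

theorem integral_corrPair (hρ : |ρ| ≤ 1) (k : Fin 2) (j : ℕ) :
    ∫ p : EuclideanSpace ℝ (Fin 2), p k ^ j ∂corrPair ρ = ∫ x, x ^ j ∂gaussianReal 0 1 :=
  integral_pow_of_hasLaw (measurePreserving_corrPair hρ k).hasLaw j

theorem integral_corrPair_one (hρ : |ρ| ≤ 1) (k : Fin 2) :
    ∫ p : EuclideanSpace ℝ (Fin 2), p k ∂corrPair ρ = 0 := by
  have := integral_corrPair hρ k 1
  rw [integral_gaussianReal_one] at this
  simpa using this

theorem integral_corrPair_mul (hρ : |ρ| ≤ 1) :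
    ∫ p : EuclideanSpace ℝ (Fin 2), p 0 * p 1 ∂corrPair ρ = ρ := by
  have h := covariance_eval_multivariateGaussian (μ := 0) (posSemidef_corr hρ) 0 1
  rw [covariance_eq_sub (memLp_corrPair hρ 0) (memLp_corrPair hρ 1), integral_corrPair_one hρ,
    zero_mul, sub_zero] at h
  simpa using h

/-- Quantitative `L²` law of large numbers; the 3 is the Gaussian fourth moment in the intended use.
-/
theorem integral_avg_sub_sq_le {X : Type*} [MeasurableSpace X] {ν : Measure X}
    [IsProbabilityMeasure ν] (hN : 0 < N) {f : X → ℝ} (hf : MemLp f 2 ν)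
    (h3 : ∫ x, f x ^ 2 ∂ν ≤ 3) :
    Integrable (fun p : Fin N → X => ((∑ i, f (p i)) / N - ∫ x, f x ∂ν) ^ 2)
        (Measure.pi fun _ => ν) ∧
      ∫ p : Fin N → X, ((∑ i, f (p i)) / N - ∫ x, f x ∂ν) ^ 2 ∂(Measure.pi fun _ => ν)
        ≤ 3 / N := by
  have hmem : ∀ i : Fin N, MemLp (fun p : Fin N → X => f (p i)) 2 (Measure.pi fun _ => ν) :=
    fun i => hf.comp_measurePreserving (measurePreserving_eval _ i)
  have hS : MemLp (fun p : Fin N → X => ∑ i, f (p i)) 2 (Measure.pi fun _ => ν) :=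
    memLp_finsetSum _ fun i _ => hmem i
  have hS' : MemLp (fun p : Fin N → X => (∑ i, f (p i)) / N) 2 (Measure.pi fun _ => ν) := by
    simpa only [div_eq_mul_inv] using hS.mul_const _
  have hN' : (N : ℝ) ≠ 0 := by positivity
  have hmean : ∫ p : Fin N → X, (∑ i, f (p i)) / N ∂(Measure.pi fun _ => ν) = ∫ x, f x ∂ν := by
    rw [integral_div, integral_finsetSum _ fun i _ => (hmem i).integrable one_le_two]
    have : ∀ i : Fin N, ∫ p : Fin N → X, f (p i) ∂(Measure.pi fun _ => ν) = ∫ x, f x ∂ν :=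
      fun i => integral_comp_eval (μ := fun _ : Fin N => ν) (i := i) hf.aestronglyMeasurable
    simp_rw [this]
    simp [hN']
  refine ⟨(hS'.sub (memLp_const _)).integrable_sq, ?_⟩
  have hvar := variance_eq_integral hS'.aestronglyMeasurable.aemeasurable
  rw [hmean] at hvar
  rw [← hvar]
  have h1 : Var[fun p : Fin N → X => ∑ i, f (p i); Measure.pi fun _ => ν] = N * Var[f; ν] := by
    have h2 : (fun p : Fin N → X => ∑ i, f (p i)) = ∑ i, fun p : Fin N → X => f (p i) := by
      ext; simp
    rw [h2, variance_sum_pi (X := fun _ => f) fun _ => hf]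
    simp
  have h4 : Var[f; ν] ≤ 3 := (variance_le_expectation_sq hf.aestronglyMeasurable).trans h3
  simp_rw [div_eq_mul_inv]
  rw [variance_mul_const, h1]
  have : (N : ℝ) * Var[f; ν] * (N : ℝ)⁻¹ ^ 2 = Var[f; ν] * (N : ℝ)⁻¹ := by
    field_simp
  rw [this]
  gcongr

theorem memLp_corrPair_mul (hρ : |ρ| ≤ 1) (k l : Fin 2) :
    MemLp (fun p : EuclideanSpace ℝ (Fin 2) => p k * p l) 2 (corrPair ρ) ∧
      ∫ p : EuclideanSpace ℝ (Fin 2), (p k * p l) ^ 2 ∂corrPair ρ ≤ 3 := by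
  have h4 : ∀ k, Integrable (fun p : EuclideanSpace ℝ (Fin 2) => p k ^ 4) (corrPair ρ) := fun k =>
    integrable_pow_of_hasLaw (measurePreserving_corrPair hρ k).hasLaw 4
  have hle : ∀ p : EuclideanSpace ℝ (Fin 2), (p k * p l) ^ 2 ≤ (p k ^ 4 + p l ^ 4) * (1 / 2) :=
    fun p => by nlinarith [sq_nonneg (p k ^ 2 - p l ^ 2)]
  have hi := ((h4 k).add (h4 l)).mul_const (1 / 2)
  constructor
  · refine (memLp_two_iff_integrable_sq (by fun_prop)).2 (hi.mono' (by fun_prop)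
      (.of_forall fun p => ?_))
    rw [Real.norm_of_nonneg (sq_nonneg _)]
    exact hle p
  · refine (integral_mono_of_nonneg (.of_forall fun p => sq_nonneg _) hi
      (.of_forall hle)).trans_eq ?_
    simp only [Pi.add_apply]
    rw [integral_mul_const, integral_add (h4 k) (h4 l), integral_corrPair hρ, integral_corrPair hρ,
      integral_fourth_gaussianReal]
    norm_num

/-- Pass through `s / N`. Replacing `ab` by `N` costs at most `|ab/N - 1|`, since `|s| ≤ ab`. This
is at most `|(ab/N)² - 1|`, which involves only the squared norms. -/
theorem abs_sub_le_of_normalized {a b s N ρ : ℝ} (ha : 0 < a) (hb : 0 < b) (hN : 0 < N)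
    (hs : |s| ≤ a * b) :
    |s / (a * b) - ρ| ≤ |a ^ 2 / N - 1| + |b ^ 2 / N - 1| + |s / N - ρ|
      + ((a ^ 2 / N - 1) ^ 2 + (b ^ 2 / N - 1) ^ 2) / 2 := by
  have hab : 0 < a * b := mul_pos ha hb
  have h1 : |s / (a * b) - s / N| ≤ |a * b / N - 1| := by
    have : s / (a * b) - s / N = -(s / (a * b)) * (a * b / N - 1) := by
      field_simp
      ring
    rw [this, abs_mul, abs_neg, abs_div, abs_of_pos hab]
    exact mul_le_of_le_one_left (abs_nonneg _) ((div_le_one hab).2 hs)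
  have h2 : |a * b / N - 1| ≤ |(a ^ 2 / N) * (b ^ 2 / N) - 1| := by
    have h3 : (a ^ 2 / N) * (b ^ 2 / N) - 1 = (a * b / N - 1) * (a * b / N + 1) := by
      field_simp
      ring
    rw [h3, abs_mul]
    refine le_mul_of_one_le_right (abs_nonneg _) ?_
    have : 0 ≤ a * b / N := by positivity
    rw [abs_of_nonneg (by linarith)]
    linarith
  have h4 : |(a ^ 2 / N) * (b ^ 2 / N) - 1| ≤ |a ^ 2 / N - 1| + |b ^ 2 / N - 1|
      + ((a ^ 2 / N - 1) ^ 2 + (b ^ 2 / N - 1) ^ 2) / 2 := by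
    set α := a ^ 2 / N - 1
    set β := b ^ 2 / N - 1
    have h5 : (a ^ 2 / N) * (b ^ 2 / N) - 1 = α + β + α * β := by ring
    rw [h5]
    refine (abs_add_le _ _).trans (add_le_add (abs_add_le _ _) ?_)
    rw [abs_mul]
    nlinarith [sq_nonneg (|α| - |β|), sq_abs α, sq_abs β]
  have h6 : |s / (a * b) - ρ| ≤ |s / (a * b) - s / N| + |s / N - ρ| := by
    have := abs_add_le (s / (a * b) - s / N) (s / N - ρ)
    simpa using this
  linarith

end Correlated

/-! ### Inner products of normalized correlated vectors -/

section CorrelatedUnit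

variable {N : ℕ} {ρ : ℝ}

/-- The law of the normalizations of two `ρ`-correlated standard Gaussian vectors. -/
def unitLaw (ρ : ℝ) (N : ℕ) : Measure (EuclideanSpace ℝ (Fin N) × EuclideanSpace ℝ (Fin N)) :=
  (corrGauss ρ N).map fun p => (unitVec (coords 0 p), unitVec (coords 1 p))

theorem measurable_coords (k : Fin 2) : Measurable (coords (n := N) k) := by
  unfold coords
  fun_prop

theorem measurable_unitPair : Measurable fun p : Fin N → EuclideanSpace ℝ (Fin 2) =>
    (unitVec (coords 0 p), unitVec (coords 1 p)) :=
  (measurable_unitVec.comp (measurable_coords 0)).prodMk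
    (measurable_unitVec.comp (measurable_coords 1))

instance : IsProbabilityMeasure (unitLaw ρ N) :=
  Measure.isProbabilityMeasure_map measurable_unitPair.aemeasurable

theorem isSphericalPair_unitLaw (hρ : |ρ| ≤ 1) (hN : 0 < N) : IsSphericalPair (unitLaw ρ N) :=
  isSphericalPair_map hN (measurePreserving_coords hρ 0) (measurePreserving_coords hρ 1)

/-- The normalized squared norms and the normalized inner product are empirical averages with
mean-square error at most `3/N`. Their contributions sum to `3 + 3 + 3/2 + 3/2 = 9` over `√N`. -/
theorem integral_abs_inner_sub_le (hρ : |ρ| ≤ 1) (hN : 0 < N) :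
    ∫ w, |inner ℝ w.1 w.2 - ρ| ∂unitLaw ρ N ≤ 9 / √N := by
  have hN' : (0 : ℝ) < N := by exact_mod_cast hN
  have hs : 0 < √(N : ℝ) := Real.sqrt_pos.2 hN'
  have hs2 : √(N : ℝ) ^ 2 = N := Real.sq_sqrt hN'.le
  unfold unitLaw
  rw [integral_map measurable_unitPair.aemeasurable (by fun_prop)]
  set A : Fin 2 → Fin 2 → (Fin N → EuclideanSpace ℝ (Fin 2)) → ℝ :=
    fun k l p => (∑ i, p i k * p i l) / N - ∫ q : EuclideanSpace ℝ (Fin 2), q k * q l ∂corrPair ρ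
    with hA
  have key := fun k l => integral_avg_sub_sq_le hN (memLp_corrPair_mul hρ k l).1
    (memLp_corrPair_mul hρ k l).2
  have hAi : ∀ k l, Integrable (fun p => A k l p ^ 2) (corrGauss ρ N) := fun k l => (key k l).1
  have hAle : ∀ k l, ∫ p, A k l p ^ 2 ∂corrGauss ρ N ≤ 3 / N := fun k l => (key k l).2
  have hdiag : ∀ k, ∫ q : EuclideanSpace ℝ (Fin 2), q k * q k ∂corrPair ρ = 1 := by
    intro k
    simp_rw [← sq]
    rw [integral_corrPair hρ, integral_sq_gaussianReal]
  have hpt : ∀ᵐ p ∂corrGauss ρ N,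
      |inner ℝ (unitVec (coords 0 p)) (unitVec (coords 1 p)) - ρ|
        ≤ (√N + 1) / 2 * A 0 0 p ^ 2 + (√N + 1) / 2 * A 1 1 p ^ 2 + √N / 2 * A 0 1 p ^ 2
          + 3 / (2 * √N) := by
    filter_upwards [(measurePreserving_coords hρ 0).quasiMeasurePreserving.ae (ae_ne_zero_gauss hN),
      (measurePreserving_coords hρ 1).quasiMeasurePreserving.ae (ae_ne_zero_gauss hN)] with p h0 h1
    have hin : inner ℝ (unitVec (coords 0 p)) (unitVec (coords 1 p))
        = inner ℝ (coords 0 p) (coords 1 p) / (‖coords 0 p‖ * ‖coords 1 p‖) := by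
      simp only [unitVec, real_inner_smul_left, real_inner_smul_right]
      field_simp
    have hA0 : A 0 0 p = ‖coords 0 p‖ ^ 2 / N - 1 := by
      simp only [hA]
      rw [hdiag, EuclideanSpace.real_norm_sq_eq]
      simp [coords, sq]
    have hA1 : A 1 1 p = ‖coords 1 p‖ ^ 2 / N - 1 := by
      simp only [hA]
      rw [hdiag, EuclideanSpace.real_norm_sq_eq]
      simp [coords, sq]
    have hA2 : A 0 1 p = inner ℝ (coords 0 p) (coords 1 p) / N - ρ := by
      simp only [hA]
      rw [integral_corrPair_mul hρ, PiLp.inner_apply]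
      simp [coords, mul_comm]
    have h2 := abs_sub_le_of_normalized (ρ := ρ) (norm_pos_iff.2 h0) (norm_pos_iff.2 h1) hN'
      (abs_real_inner_le_norm (coords 0 p) (coords 1 p))
    rw [← hin, ← hA0, ← hA1, ← hA2] at h2
    -- AM–GM weighted so that both terms are of order `1/√N` when `x²` is of order `1/N`.
    have hamgm : ∀ x : ℝ, |x| ≤ √N / 2 * x ^ 2 + 1 / (2 * √N) := by
      intro x
      have h3 : 0 ≤ (√N * |x| - 1) ^ 2 / (2 * √N) := by positivity
      have h4 : (√N * |x| - 1) ^ 2 / (2 * √N) = √N / 2 * x ^ 2 + 1 / (2 * √N) - |x| := by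
        rw [← sq_abs x]
        field_simp
        ring
      linarith
    have e0 := hamgm (A 0 0 p)
    have e1 := hamgm (A 1 1 p)
    have e2 := hamgm (A 0 1 p)
    have e3 : 3 / (2 * √(N : ℝ)) = 3 * (1 / (2 * √N)) := by ring
    rw [e3]
    linarith
  have hint := ((((hAi 0 0).const_mul ((√N + 1) / 2)).add ((hAi 1 1).const_mul ((√N + 1) / 2))).add
    ((hAi 0 1).const_mul (√N / 2))).add (integrable_const (3 / (2 * √(N : ℝ))))
  refine (integral_mono_of_nonneg (.of_forall fun _ => abs_nonneg _) hint hpt).trans ?_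
  simp only [Pi.add_apply]
  rw [integral_add, integral_add, integral_add, integral_const_mul, integral_const_mul,
    integral_const_mul, integral_const, probReal_univ, one_smul]
  · have b0 := mul_le_mul_of_nonneg_left (hAle 0 0) (by positivity : 0 ≤ (√(N : ℝ) + 1) / 2)
    have b1 := mul_le_mul_of_nonneg_left (hAle 1 1) (by positivity : 0 ≤ (√(N : ℝ) + 1) / 2)
    have b2 := mul_le_mul_of_nonneg_left (hAle 0 1) (by positivity : 0 ≤ √(N : ℝ) / 2)
    have hone : 1 ≤ √(N : ℝ) := Real.one_le_sqrt.2 (by exact_mod_cast hN)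
    have c0 : (3 : ℝ) / N = 3 / √N / √N := by rw [div_div, ← sq, hs2]
    have c1 : √(N : ℝ) / 2 * (3 / N) = 3 / 2 / √N := by
      rw [c0]; field_simp
    have c2 : (√(N : ℝ) + 1) / 2 * (3 / N) ≤ 3 / √N := by
      have h1 : (√(N : ℝ) + 1) / 2 / √N ≤ 1 := (div_le_one hs).2 (by linarith)
      have h2 : (√(N : ℝ) + 1) / 2 * (3 / N) = (√(N : ℝ) + 1) / 2 / √N * (3 / √N) := by
        rw [c0]; ring
      rw [h2]
      exact mul_le_of_le_one_left (by positivity) h1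
    have c3 : 3 / (2 * √(N : ℝ)) = 3 / 2 / √N := by field_simp
    have c4 : 9 / √(N : ℝ) = 3 / √N + 3 / √N + 3 / 2 / √N + 3 / 2 / √N := by ring
    linarith
  · exact (hAi 0 0).const_mul _
  · exact (hAi 1 1).const_mul _
  · exact ((hAi 0 0).const_mul _).add ((hAi 1 1).const_mul _)
  · exact (hAi 0 1).const_mul _
  · exact (((hAi 0 0).const_mul _).add ((hAi 1 1).const_mul _)).add ((hAi 0 1).const_mul _)
  · exact integrable_const _

/-- On `[-1, 1]` the power `t ↦ t^s` is `s`-Lipschitz. -/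
theorem abs_integral_inner_pow_sub_le (hρ : |ρ| ≤ 1) (hN : 0 < N) (s : ℕ) :
    |∫ w, inner ℝ w.1 w.2 ^ s ∂unitLaw ρ N - ρ ^ s| ≤ s * (9 / √N) := by
  have hμ := isSphericalPair_unitLaw hρ hN
  have h1 : ∫ w, inner ℝ w.1 w.2 ^ s ∂unitLaw ρ N - ρ ^ s
      = ∫ w, (inner ℝ w.1 w.2 ^ s - ρ ^ s) ∂unitLaw ρ N := by
    rw [integral_sub (hμ.integrable (by fun_prop)) (integrable_const _), integral_const,
      probReal_univ, one_smul]
  rw [h1]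
  refine abs_integral_le_integral_abs.trans ?_
  refine le_trans ?_ (mul_le_mul_of_nonneg_left (integral_abs_inner_sub_le hρ hN)
    (Nat.cast_nonneg s))
  rw [← integral_const_mul]
  refine integral_mono_ae (hμ.integrable (by fun_prop)) (hμ.integrable (by fun_prop)) ?_
  filter_upwards [hμ.norm_fst, hμ.norm_snd] with w h2 h3
  refine (abs_pow_sub_pow_le _ _ s).trans ?_
  have h4 : |inner ℝ w.1 w.2| ≤ 1 := by
    simpa [h2, h3] using abs_real_inner_le_norm w.1 w.2
  rw [mul_comm |_| (s : ℝ)]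
  exact mul_le_of_le_one_right (by positivity)
    (pow_le_one₀ (le_max_of_le_left (abs_nonneg _)) (max_le h4 hρ))

end CorrelatedUnit

/-! ### The correlation form of a state with maximally mixed marginals -/

section Correlation

open Matrix
open Herm (mat)

theorem norm_trace_conjTranspose_mul_sq_le {ι : Type*} [Fintype ι] (X Y : Matrix ι ι ℂ) :
    ‖(Xᴴ * Y).trace‖ ^ 2 ≤ (Xᴴ * X).trace.re * (Yᴴ * Y).trace.re := by
  have h0 : ∀ Z : Matrix ι ι ℂ, (Zᴴ * Z).trace.re = ∑ p : ι × ι, ‖Z p.1 p.2‖ ^ 2 := by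
    intro Z
    rw [Fintype.sum_prod_type, Finset.sum_comm]
    simp only [Matrix.trace, Matrix.diag_apply, Matrix.mul_apply, Matrix.conjTranspose_apply,
      Complex.re_sum]
    refine Finset.sum_congr rfl fun i _ => Finset.sum_congr rfl fun j _ => ?_
    rw [RCLike.star_def, Complex.conj_mul']
    norm_cast
  have h1 : ‖(Xᴴ * Y).trace‖ ≤ ∑ p : ι × ι, ‖X p.1 p.2‖ * ‖Y p.1 p.2‖ := by
    rw [Fintype.sum_prod_type, Finset.sum_comm]
    simp only [Matrix.trace, Matrix.diag_apply, Matrix.mul_apply, Matrix.conjTranspose_apply]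
    refine (norm_sum_le _ _).trans (Finset.sum_le_sum fun i _ => ?_)
    refine (norm_sum_le _ _).trans (Finset.sum_le_sum fun j _ => ?_)
    rw [norm_mul, norm_star]
  rw [h0, h0]
  exact (pow_le_pow_left₀ (norm_nonneg _) h1 2).trans (Finset.sum_mul_sq_le_sq_mul_sq _ _ _)

variable {m h : ℕ}

theorem prod_sum_eq_sum_prod {R : Type*} [CommSemiring R] {κ : Type*} [Fintype κ]
    (f : Fin h → κ → R) : ∏ i, ∑ j, f i j = ∑ g : Fin h → κ, ∏ i, f i (g i) := by
  classical
  rw [Finset.prod_univ_sum, Fintype.piFinset_univ]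

theorem tensorPower_mul (A B : Matrix (Fin m × Fin m) (Fin m × Fin m) ℂ) :
    tensorPower (A * B) h = tensorPower A h * tensorPower B h := by
  ext p q
  simp only [tensorPower, Matrix.mul_apply]
  rw [prod_sum_eq_sum_prod, ← (Equiv.arrowProdEquivProdArrow (Fin h) (fun _ => Fin m)
    (fun _ => Fin m)).sum_comp]
  exact Finset.sum_congr rfl fun g _ => Finset.prod_mul_distrib

theorem tensorPower_conjTranspose (A : Matrix (Fin m × Fin m) (Fin m × Fin m) ℂ) :
    tensorPower Aᴴ h = (tensorPower A h)ᴴ := by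
  ext p q
  simp [tensorPower, Matrix.conjTranspose_apply]

/-- The marginal of the tensor power is the tensor power of the marginal, hence again maximally
mixed. -/
theorem sum_tensorPower_snd {ψ : Matrix (Fin m × Fin m) (Fin m × Fin m) ℂ} (hψ : IsNoisyMES ψ)
    (a a' : Reg m h) :
    ∑ b, tensorPower ψ h (a, b) (a', b) = (1 / (Fintype.card (Reg m h) : ℂ)) *
      (1 : Matrix (Reg m h) (Reg m h) ℂ) a a' := by
  have h1 : ∀ i, ∑ b, ψ (a i, b) (a' i, b) = (1 / (m : ℂ)) * if a i = a' i then 1 else 0 := by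
    intro i
    have := congrFun (congrFun hψ.marginalA (a i)) (a' i)
    simpa [partialTraceB, Matrix.one_apply] using this
  refine (prod_sum_eq_sum_prod fun i b => ψ (a i, b) (a' i, b)).symm.trans ?_
  simp_rw [h1]
  rw [Finset.prod_mul_distrib, Finset.prod_const, Matrix.one_apply]
  simp [Finset.prod_ite_zero, funext_iff]

theorem sum_tensorPower_fst {ψ : Matrix (Fin m × Fin m) (Fin m × Fin m) ℂ} (hψ : IsNoisyMES ψ)
    (b b' : Reg m h) :
    ∑ a, tensorPower ψ h (a, b) (a, b') = (1 / (Fintype.card (Reg m h) : ℂ)) *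
      (1 : Matrix (Reg m h) (Reg m h) ℂ) b b' := by
  have h1 : ∀ i, ∑ a, ψ (a, b i) (a, b' i) = (1 / (m : ℂ)) * if b i = b' i then 1 else 0 := by
    intro i
    have := congrFun (congrFun hψ.marginalB (b i)) (b' i)
    simpa [partialTraceA, Matrix.one_apply] using this
  refine (prod_sum_eq_sum_prod fun i a => ψ (a, b i) (a, b' i)).symm.trans ?_
  simp_rw [h1]
  rw [Finset.prod_mul_distrib, Finset.prod_const, Matrix.one_apply]
  simp [Finset.prod_ite_zero, funext_iff]

theorem trace_kronecker_one_mul_tensorPower {ψ : Matrix (Fin m × Fin m) (Fin m × Fin m) ℂ}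
    (hψ : IsNoisyMES ψ) (A : Matrix (Reg m h) (Reg m h) ℂ) :
    ((A ⊗ₖ (1 : Matrix (Reg m h) (Reg m h) ℂ)) * tensorPower ψ h).trace
      = (1 / (Fintype.card (Reg m h) : ℂ)) * A.trace := by
  have h1 : ((A ⊗ₖ (1 : Matrix (Reg m h) (Reg m h) ℂ)) * tensorPower ψ h).trace
      = ∑ a, ∑ a', A a a' * ∑ b, tensorPower ψ h (a', b) (a, b) := by
    simp only [Matrix.trace, Matrix.diag_apply, Matrix.mul_apply, Fintype.sum_prod_type,
      Matrix.kroneckerMap_apply, Matrix.one_apply, Finset.mul_sum]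
    refine Finset.sum_congr rfl fun a _ => ?_
    rw [Finset.sum_comm]
    refine Finset.sum_congr rfl fun a' _ => ?_
    refine Finset.sum_congr rfl fun b _ => ?_
    simp
  rw [h1]
  simp_rw [sum_tensorPower_snd hψ, Matrix.one_apply]
  simp [Matrix.trace, Finset.mul_sum, mul_comm]

theorem trace_one_kronecker_mul_tensorPower {ψ : Matrix (Fin m × Fin m) (Fin m × Fin m) ℂ}
    (hψ : IsNoisyMES ψ) (A : Matrix (Reg m h) (Reg m h) ℂ) :
    (((1 : Matrix (Reg m h) (Reg m h) ℂ) ⊗ₖ A) * tensorPower ψ h).trace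
      = (1 / (Fintype.card (Reg m h) : ℂ)) * A.trace := by
  have h1 : (((1 : Matrix (Reg m h) (Reg m h) ℂ) ⊗ₖ A) * tensorPower ψ h).trace
      = ∑ b, ∑ b', A b b' * ∑ a, tensorPower ψ h (a, b') (a, b) := by
    simp only [Matrix.trace, Matrix.diag_apply, Matrix.mul_apply, Fintype.sum_prod_type,
      Matrix.kroneckerMap_apply, Matrix.one_apply, Finset.mul_sum]
    rw [Finset.sum_comm]
    refine Finset.sum_congr rfl fun b _ => ?_
    rw [Finset.sum_comm]
    conv_lhs => enter [2, a]; rw [Finset.sum_comm]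
    rw [Finset.sum_comm]
    simp
  rw [h1]
  simp_rw [sum_tensorPower_fst hψ, Matrix.one_apply]
  simp [Matrix.trace, Finset.mul_sum, mul_comm]

theorem norm_sq_eq (P : Herm m h) :
    ‖P‖ ^ 2 = (1 / (Fintype.card (Reg m h) : ℝ)) * ((mat P)ᴴ * mat P).trace.re := by
  rw [Herm.norm_eq_nnorm2, nnorm2, Real.sq_sqrt]
  exact mul_nonneg (by positivity)
    (Complex.le_def.1 (Matrix.posSemidef_conjTranspose_mul_self (mat P)).trace_nonneg).1

open scoped MatrixOrder in
theorem exists_eq_conjTranspose_mul_self {ι : Type*} [Fintype ι] [DecidableEq ι]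
    {A : Matrix ι ι ℂ} (hA : A.PosSemidef) : ∃ K : Matrix ι ι ℂ, A = Kᴴ * K :=
  CStarAlgebra.nonneg_iff_eq_star_mul_self.1 hA.nonneg

/-- Factor `ψ^{⊗h} = Tᴴ T`. The correlation is then the Hilbert–Schmidt product of `(P ⊗ 1) Tᴴ` and
`(1 ⊗ Q) Tᴴ`, whose squared norms see only the marginals and equal `‖P‖²` and `‖Q‖²`. -/
theorem norm_corr_le {ψ : Matrix (Fin m × Fin m) (Fin m × Fin m) ℂ} (hψ : IsNoisyMES ψ)
    (P Q : Herm m h) : ‖corr ψ P Q‖ ≤ ‖P‖ * ‖Q‖ := by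
  obtain ⟨K, hK⟩ := exists_eq_conjTranspose_mul_self hψ.posSemidef
  set T := tensorPower K h with hT
  have hΨ : tensorPower ψ h = Tᴴ * T := by
    rw [hK, tensorPower_mul, tensorPower_conjTranspose]
  set X := (mat P ⊗ₖ (1 : Matrix (Reg m h) (Reg m h) ℂ)) * Tᴴ with hX
  set Y := ((1 : Matrix (Reg m h) (Reg m h) ℂ) ⊗ₖ mat Q) * Tᴴ with hY
  have hP : (mat P)ᴴ = mat P := P.isHermitian
  have hQ : (mat Q)ᴴ = mat Q := Q.isHermitian
  have hXH : Xᴴ = T * (mat P ⊗ₖ (1 : Matrix (Reg m h) (Reg m h) ℂ)) := by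
    rw [hX, Matrix.conjTranspose_mul, Matrix.conjTranspose_conjTranspose,
      Matrix.conjTranspose_kronecker, hP, Matrix.conjTranspose_one]
  have hYH : Yᴴ = T * ((1 : Matrix (Reg m h) (Reg m h) ℂ) ⊗ₖ mat Q) := by
    rw [hY, Matrix.conjTranspose_mul, Matrix.conjTranspose_conjTranspose,
      Matrix.conjTranspose_kronecker, hQ, Matrix.conjTranspose_one]
  have h1 : corr ψ P Q = (Xᴴ * Y).trace := by
    rw [corr, hΨ, hXH, hY, ← Matrix.mul_assoc, Matrix.trace_mul_comm, Matrix.mul_assoc T,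
      ← Matrix.mul_assoc (_ ⊗ₖ _), ← Matrix.mul_kronecker_mul, Matrix.mul_one, Matrix.one_mul]
  have h2 : (Xᴴ * X).trace.re = ‖P‖ ^ 2 := by
    rw [hXH, hX, Matrix.mul_assoc, Matrix.trace_mul_comm, ← Matrix.mul_assoc (_ ⊗ₖ _),
      ← Matrix.mul_kronecker_mul, Matrix.mul_one, Matrix.mul_assoc, ← hΨ,
      trace_kronecker_one_mul_tensorPower hψ, norm_sq_eq, hP,
      show (1 / (Fintype.card (Reg m h) : ℂ)) = ((1 / (Fintype.card (Reg m h) : ℝ) : ℝ) : ℂ) by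
        push_cast; rfl, Complex.re_ofReal_mul]
  have h3 : (Yᴴ * Y).trace.re = ‖Q‖ ^ 2 := by
    rw [hYH, hY, Matrix.mul_assoc, Matrix.trace_mul_comm, ← Matrix.mul_assoc (_ ⊗ₖ _),
      ← Matrix.mul_kronecker_mul, Matrix.mul_one, Matrix.mul_assoc, ← hΨ,
      trace_one_kronecker_mul_tensorPower hψ, norm_sq_eq, hQ,
      show (1 / (Fintype.card (Reg m h) : ℂ)) = ((1 / (Fintype.card (Reg m h) : ℝ) : ℝ) : ℂ) by
        push_cast; rfl, Complex.re_ofReal_mul]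
  refine le_of_sq_le_sq ?_ (by positivity)
  rw [h1, mul_pow, ← h2, ← h3]
  exact norm_trace_conjTranspose_mul_sq_le X Y

theorem corr_eq_re {ψ : Matrix (Fin m × Fin m) (Fin m × Fin m) ℂ} (hψ : IsNoisyMES ψ)
    (P Q : Herm m h) : corr ψ P Q = ((corr ψ P Q).re : ℂ) := by
  have hP : (mat P)ᴴ = mat P := P.isHermitian
  have hQ : (mat Q)ᴴ = mat Q := Q.isHermitian
  have hψ' : (tensorPower ψ h)ᴴ = tensorPower ψ h := by
    rw [← tensorPower_conjTranspose, hψ.posSemidef.isHermitian.eq]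
  refine (Complex.conj_eq_iff_re.1 ?_).symm
  change star (corr ψ P Q) = _
  rw [corr, ← Matrix.trace_conjTranspose, Matrix.conjTranspose_mul, Matrix.conjTranspose_kronecker,
    hP, hQ, hψ', Matrix.trace_mul_comm]

/-- The correlation of two Hermitian operators as a continuous real bilinear form. -/
def corrForm {ψ : Matrix (Fin m × Fin m) (Fin m × Fin m) ℂ} (hψ : IsNoisyMES ψ) (h : ℕ) :
    Herm m h →L[ℝ] Herm m h →L[ℝ] ℝ :=
  (LinearMap.mk₂ ℝ (fun P Q : Herm m h => (corr ψ P Q).re)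
    (fun P P' Q => by simp [corr, Matrix.add_kronecker, Matrix.add_mul])
    (fun r P Q => by simp [corr, Matrix.smul_kronecker])
    (fun P Q Q' => by simp [corr, Matrix.kronecker_add, Matrix.add_mul])
    (fun r P Q => by simp [corr, Matrix.kronecker_smul])).mkContinuous₂ 1 fun P Q => by
      rw [one_mul]
      exact (Complex.abs_re_le_norm _).trans (norm_corr_le hψ P Q)

theorem corrForm_apply {ψ : Matrix (Fin m × Fin m) (Fin m × Fin m) ℂ} (hψ : IsNoisyMES ψ)
    (P Q : Herm m h) : corrForm hψ h P Q = (corr ψ P Q).re := rfl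

theorem abs_corrForm_le {ψ : Matrix (Fin m × Fin m) (Fin m × Fin m) ℂ} (hψ : IsNoisyMES ψ)
    (P Q : Herm m h) : |corrForm hψ h P Q| ≤ ‖P‖ * ‖Q‖ :=
  (Complex.abs_re_le_norm _).trans (norm_corr_le hψ P Q)

/-- Together with the strict upper bound this makes the correlated Gaussian covariance positive
semidefinite. -/
theorem maximalCorrelation_nonneg (ψ : Matrix (Fin m × Fin m) (Fin m × Fin m) ℂ) :
    0 ≤ maximalCorrelation ψ := by
  refine Real.sSup_nonneg ?_
  rintro r ⟨P, Q, -, -, -, -, rfl⟩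
  exact norm_nonneg _

end Correlation

/-! ### Exact invariance of the Gaussian law under random projection -/

section PushForward

variable {n k m h : ℕ}

theorem proj_eq_act (M : Fin n → Fin k → ℝ) (x : EuclideanSpace ℝ (Fin k)) :
    proj (Matrix.of M) x = WithLp.toLp 2 (act M (unitVec x)) := rfl

theorem evalPoly_eq_mlin (P : Finset (Fin n) → Herm m h) (z : EuclideanSpace ℝ (Fin n)) :
    evalPoly P z = mlin Finset.univ P z := by
  rw [evalPoly, mlin, Finset.powerset_univ]

theorem continuous_evalPoly (P : Finset (Fin n) → Herm m h) : Continuous (evalPoly P) := by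
  unfold evalPoly
  fun_prop

theorem measurePreserving_act {u : EuclideanSpace ℝ (Fin k)} (hu : ‖u‖ = 1) :
    MeasurePreserving (fun M : Fin n → Fin k → ℝ => WithLp.toLp 2 (act M u)) (gaussMatrix n k)
      (gauss n) := by
  have hu' : ∑ j, u j ^ 2 = 1 := by
    rw [← EuclideanSpace.real_norm_sq_eq, hu, one_pow]
  refine measurePreserving_toLp.comp (measurePreserving_pi _ _
    (f := fun _ (r : Fin k → ℝ) => ∑ j, r j * u j) fun _ => ⟨by fun_prop, (hasLaw_sum_mul hu').map_eq⟩)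

/-- Conditionally on `x ≠ 0` the image is already standard Gaussian, and `x = 0` is a null event
because `k > 0`. -/
theorem measurePreserving_proj (hk : 0 < k) :
    MeasurePreserving (fun w : (Fin n → Fin k → ℝ) × EuclideanSpace ℝ (Fin k) =>
      proj (Matrix.of w.1) w.2) ((gaussMatrix n k).prod (gauss k)) (gauss n) := by
  have hm : Measurable fun w : (Fin n → Fin k → ℝ) × EuclideanSpace ℝ (Fin k) =>
      proj (Matrix.of w.1) w.2 := by
    have h1 := continuous_act.measurable.comp
      (measurable_fst.prodMk (measurable_unitVec.comp measurable_snd) :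
        Measurable fun w : (Fin n → Fin k → ℝ) × EuclideanSpace ℝ (Fin k) => (w.1, unitVec w.2))
    exact measurePreserving_toLp.measurable.comp h1
  refine ⟨hm, Measure.ext fun s hs => ?_⟩
  rw [Measure.map_apply hm hs, Measure.prod_apply_symm (hm hs)]
  have h1 : ∀ᵐ x ∂gauss k, gaussMatrix n k ((fun M => (M, x)) ⁻¹'
      ((fun w : (Fin n → Fin k → ℝ) × EuclideanSpace ℝ (Fin k) =>
        proj (Matrix.of w.1) w.2) ⁻¹' s)) = gauss n s := by
    filter_upwards [ae_ne_zero_gauss hk] with x hx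
    exact (measurePreserving_act (norm_unitVec hx)).measure_preimage hs.nullMeasurableSet
  rw [lintegral_congr_ae h1]
  simp

theorem continuous_zeta : Continuous zeta := by
  refine Continuous.if_le (by fun_prop) (by fun_prop) continuous_id continuous_const ?_
  rintro x rfl
  norm_num

-- Continuity of the functional calculus, used for measurability in the change of variables.
open scoped Matrix.Norms.L2Operator in
theorem continuous_traceZeta_evalPoly (P : Finset (Fin n) → Herm m h) :
    Continuous fun z => traceZeta (evalPoly P z) := by
  have h1 : Continuous fun z => Herm.mat (evalPoly P z) := by
    simp only [evalPoly, map_sum, map_smul]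
    fun_prop
  have h2 : Continuous fun z => cfc zeta (Herm.mat (evalPoly P z)) :=
    h1.cfc_of_mem_nhdsSet zeta Filter.univ_mem
      (fun z => (evalPoly P z).isHermitian) continuous_zeta.continuousOn
  have h3 : ∀ z, traceZeta (evalPoly P z) = (cfc zeta (Herm.mat (evalPoly P z))).trace.re :=
    fun z => by rw [traceZeta, Matrix.IsHermitian.cfc_eq]
  simp_rw [h3]
  exact Complex.continuous_re.comp (Continuous.matrix_trace h2)

theorem integral_traceZeta_proj (hk : 0 < k) (P : Finset (Fin n) → Herm m h) :
    ∫ z, traceZeta (evalPoly P z) ∂gauss n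
      = ∫ w, traceZeta (evalPoly P (proj (Matrix.of w.1) w.2))
        ∂(gaussMatrix n k).prod (gauss k) := by
  have hmp := measurePreserving_proj (n := n) hk
  rw [← hmp.map_eq, integral_map hmp.aemeasurable
    (continuous_traceZeta_evalPoly P).aestronglyMeasurable]

end PushForward

/-! ### The linear unital maps on `L²` -/

section Projection

variable {n k m h : ℕ}

instance : FiniteDimensional ℝ (Herm m h) := by
  have : FiniteDimensional ℝ (Matrix (Reg m h) (Reg m h) ℂ) :=
    FiniteDimensional.trans ℝ ℂ _
  exact FiniteDimensional.of_injective Herm.mat Herm.mat_injective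

instance : CompleteSpace (Herm m h) := FiniteDimensional.complete ℝ _

theorem integral_monomial_mul_monomial (S T : Finset (Fin n)) :
    ∫ z : EuclideanSpace ℝ (Fin n), (∏ i ∈ S, z i) * ∏ i ∈ T, z i ∂gauss n
      = if S = T then 1 ^ S.card else 0 := by
  rw [← measurePreserving_toLp.map_eq, integral_map (by fun_prop)
    (Continuous.aestronglyMeasurable (by fun_prop))]
  refine integral_prod_mul_prod_pi (ν := gaussianReal 0 1) (a := fun x => x) (b := fun x => x)
    ?_ ?_ ?_ S T
  · simp
  · simp
  · simpa [sq] using integral_sq_gaussianReal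

/-- The coefficient of the monomial indexed by `S` in a random matrix. -/
def chaosCoeff (F : L2Herm m h n) (S : Finset (Fin n)) : Herm m h :=
  ∫ z, (∏ i ∈ S, z i) • F z ∂gauss n

theorem integrable_monomial_smul (F : L2Herm m h n) (S : Finset (Fin n)) :
    Integrable (fun z : EuclideanSpace ℝ (Fin n) => (∏ i ∈ S, z i) • F z) (gauss n) :=
  (memLp_one_iff_integrable.1 ((Lp.memLp F).smul (memLp_monomial S) (r := 1)))

theorem chaosCoeff_add (F G : L2Herm m h n) : chaosCoeff (F + G) = chaosCoeff F + chaosCoeff G := by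
  funext S
  simp only [chaosCoeff, Pi.add_apply]
  rw [← integral_add (integrable_monomial_smul F S) (integrable_monomial_smul G S)]
  refine integral_congr_ae ?_
  filter_upwards [Lp.coeFn_add F G] with z hz
  rw [hz, Pi.add_apply, smul_add]

theorem chaosCoeff_smul (r : ℝ) (F : L2Herm m h n) : chaosCoeff (r • F) = r • chaosCoeff F := by
  funext S
  simp only [chaosCoeff, Pi.smul_apply]
  rw [← integral_smul]
  refine integral_congr_ae ?_
  filter_upwards [Lp.coeFn_smul r F] with z hz
  rw [hz, Pi.smul_apply, smul_comm]

/-- Multilinear monomials are orthonormal under the Gaussian measure. -/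
theorem chaosCoeff_toL2 (P : Finset (Fin n) → Herm m h) : chaosCoeff (toL2 P) = P := by
  funext S
  have h1 : chaosCoeff (toL2 P) S
      = ∫ z, ∑ T, ((∏ i ∈ S, z i) * ∏ i ∈ T, z i) • P T ∂gauss n := by
    refine integral_congr_ae ?_
    filter_upwards [(memLp_evalPoly P).coeFn_toLp] with z hz
    rw [toL2, hz, evalPoly, Finset.smul_sum]
    simp_rw [smul_smul]
  have hi : ∀ T, Integrable (fun z : EuclideanSpace ℝ (Fin n) =>
      ((∏ i ∈ S, z i) * ∏ i ∈ T, z i) • P T) (gauss n) := fun T =>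
    ((memLp_monomial S).integrable_mul (memLp_monomial T)).smul_const _
  rw [h1, integral_finsetSum _ fun T _ => hi T]
  simp_rw [integral_smul_const, integral_monomial_mul_monomial]
  simp

/-- Normalization confines the argument to the unit ball, where the polynomial is bounded. -/
theorem memLp_evalPoly_proj (M : Matrix (Fin n) (Fin k) ℝ) (P : Finset (Fin n) → Herm m h) :
    MemLp (fun x => evalPoly P (proj M x)) 2 (gauss k) := by
  have hc : Continuous fun u : EuclideanSpace ℝ (Fin k) => evalPoly P (WithLp.toLp 2 (act M u)) := by
    have h1 : Continuous fun u : EuclideanSpace ℝ (Fin k) => act M u :=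
      continuous_act.comp (by fun_prop : Continuous fun u : EuclideanSpace ℝ (Fin k) =>
        ((M : Fin n → Fin k → ℝ), u))
    exact (continuous_evalPoly P).comp (by fun_prop)
  obtain ⟨C, hC⟩ := (isCompact_closedBall (0 : EuclideanSpace ℝ (Fin k)) 1).exists_bound_of_continuousOn
    hc.continuousOn
  refine MemLp.of_bound (hc.stronglyMeasurable.comp_measurable
    measurable_unitVec).aestronglyMeasurable C (.of_forall fun x => ?_)
  exact hC (unitVec x) (mem_closedBall_zero_iff.2 (norm_unitVec_le x))

/-- The map taking `P(g)` to `P(M x̃)`, extended to `L²` through the projection onto multilinear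
polynomials. -/
def reduce (M : Matrix (Fin n) (Fin k) ℝ) (F : L2Herm m h n) : L2Herm m h k :=
  (memLp_evalPoly_proj M (chaosCoeff F)).toLp _

theorem reduce_toL2 (M : Matrix (Fin n) (Fin k) ℝ) (P : Finset (Fin n) → Herm m h) :
    reduce M (toL2 P) =ᵐ[gauss k] fun x => evalPoly P (proj M x) := by
  unfold reduce
  filter_upwards [(memLp_evalPoly_proj M (chaosCoeff (toL2 P))).coeFn_toLp] with x hx
  rw [hx, chaosCoeff_toL2]

theorem isLinearMap_reduce (M : Matrix (Fin n) (Fin k) ℝ) :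
    IsLinearMap ℝ (reduce M : L2Herm m h n → L2Herm m h k) := by
  constructor
  · intro F G
    unfold reduce
    rw [← MemLp.toLp_add]
    congr 1
    funext x
    simp [chaosCoeff_add, evalPoly, smul_add, Finset.sum_add_distrib]
  · intro r F
    unfold reduce
    rw [← MemLp.toLp_const_smul]
    congr 1
    funext x
    simp only [chaosCoeff_smul, evalPoly, Pi.smul_apply, Finset.smul_sum]
    exact Finset.sum_congr rfl fun S _ => smul_comm _ _ _

theorem reduce_id (M : Matrix (Fin n) (Fin k) ℝ) : reduce M (idL2 m h n) = idL2 m h k := by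
  set P : Finset (Fin n) → Herm m h := fun S => if S = ∅ then Herm.id m h else 0 with hP
  have hev : ∀ z, evalPoly P z = Herm.id m h := by
    intro z
    simp [evalPoly, hP]
  have h1 : idL2 m h n = toL2 P := by
    refine Lp.ext ?_
    filter_upwards [Lp.coeFn_const 2 (gauss n) (Herm.id m h),
      (memLp_evalPoly P).coeFn_toLp] with z h2 h3
    rw [idL2, h2, toL2, h3, hev]
    rfl
  rw [h1]
  refine Lp.ext ?_
  filter_upwards [Lp.coeFn_const 2 (gauss k) (Herm.id m h), reduce_toL2 M P] with x h2 h3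
  rw [h3, hev, idL2, h2]
  rfl

end Projection

/-! ### The two target quantities as averaged pairings -/

section SecondMoment

variable {n k m h : ℕ}

/-- The inner product of Hermitian operators as a continuous real bilinear form. -/
def innerForm (m h : ℕ) : Herm m h →L[ℝ] Herm m h →L[ℝ] ℝ := innerSL ℝ

theorem innerForm_self (P : Herm m h) : innerForm m h P P = ‖P‖ ^ 2 :=
  real_inner_self_eq_norm_sq P

theorem abs_innerForm_le (P Q : Herm m h) : |innerForm m h P Q| ≤ ‖P‖ * ‖Q‖ :=
  abs_real_inner_le_norm P Q

theorem integral_norm_evalPoly_sq (P : Finset (Fin n) → Herm m h) :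
    ∫ z, ‖evalPoly P z‖ ^ 2 ∂gauss n = ∑ S, ‖P S‖ ^ 2 := by
  have h1 := integral_bilin_mlin (P := gauss n) (X := fun z => z) (Y := fun z => z) P P
    (innerForm m h) memLp_monomial memLp_monomial integral_monomial_mul_monomial
  simpa [evalPoly_eq_mlin, innerForm_self] using h1

theorem integral_corrForm_evalPoly {ψ : Matrix (Fin m × Fin m) (Fin m × Fin m) ℂ}
    (hψ : IsNoisyMES ψ) {ρ : ℝ} (hρ : |ρ| ≤ 1) (P Q : Finset (Fin n) → Herm m h) :
    ∫ p, corrForm hψ h (evalPoly P (coords 0 p)) (evalPoly Q (coords 1 p)) ∂corrGauss ρ n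
      = ∑ S, ρ ^ S.card * corrForm hψ h (P S) (Q S) := by
  simp_rw [evalPoly_eq_mlin]
  exact integral_bilin_mlin P Q (corrForm hψ h)
    (fun S => (memLp_monomial S).comp_measurePreserving (measurePreserving_coords hρ 0))
    (fun S => (memLp_monomial S).comp_measurePreserving (measurePreserving_coords hρ 1))
    (integral_prod_mul_prod_pi (ν := corrPair ρ) (a := fun q => q 0) (b := fun q => q 1)
      (integral_corrPair_one hρ 0) (integral_corrPair_one hρ 1) (integral_corrPair_mul hρ))

/-- The law of two copies of one uniformly distributed unit vector. -/
def unitDiag (k : ℕ) : Measure (EuclideanSpace ℝ (Fin k) × EuclideanSpace ℝ (Fin k)) :=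
  (gauss k).map fun x => (unitVec x, unitVec x)

instance : IsProbabilityMeasure (unitDiag k) :=
  Measure.isProbabilityMeasure_map (measurable_unitVec.prodMk measurable_unitVec).aemeasurable

theorem isSphericalPair_unitDiag (hk : 0 < k) : IsSphericalPair (unitDiag k) :=
  isSphericalPair_map hk (MeasurePreserving.id _) (MeasurePreserving.id _)

theorem integral_nnorm2_proj_sq (P : Finset (Fin n) → Herm m h) (M : Fin n → Fin k → ℝ) :
    ∫ x, nnorm2 (Herm.mat (evalPoly P (proj (Matrix.of M) x))) ^ 2 ∂gauss k
      = pairAvg (unitDiag k) (innerForm m h) P P M := by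
  have hc : Continuous fun w => pairVal (innerForm m h) P P M w :=
    continuous_pairVal _ P P continuous_const continuous_id
  unfold pairAvg unitDiag
  rw [integral_map (measurable_unitVec.prodMk measurable_unitVec).aemeasurable
    hc.aestronglyMeasurable]
  refine integral_congr_ae (.of_forall fun x => ?_)
  simp only [← Herm.norm_eq_nnorm2, pairVal, innerForm_self,
    proj_eq_act, evalPoly_eq_mlin]

theorem integral_corr_proj {ψ : Matrix (Fin m × Fin m) (Fin m × Fin m) ℂ} (hψ : IsNoisyMES ψ)
    (ρ : ℝ) (P Q : Finset (Fin n) → Herm m h) (M : Fin n → Fin k → ℝ) :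
    ∫ p, corr ψ (evalPoly P (proj (Matrix.of M) (coords 0 p)))
        (evalPoly Q (proj (Matrix.of M) (coords 1 p))) ∂corrGauss ρ k
      = (pairAvg (unitLaw ρ k) (corrForm hψ h) P Q M : ℂ) := by
  have hc : Continuous fun w => pairVal (corrForm hψ h) P Q M w :=
    continuous_pairVal _ P Q continuous_const continuous_id
  unfold pairAvg unitLaw
  rw [integral_map measurable_unitPair.aemeasurable
    hc.aestronglyMeasurable,
    ← integral_complex_ofReal]
  refine integral_congr_ae (.of_forall fun p => ?_)
  simp only [pairVal, corrForm_apply, proj_eq_act, evalPoly_eq_mlin]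
  exact corr_eq_re hψ _ _

theorem integral_corr_evalPoly {ψ : Matrix (Fin m × Fin m) (Fin m × Fin m) ℂ}
    (hψ : IsNoisyMES ψ) {ρ : ℝ} (hρ : |ρ| ≤ 1) (P Q : Finset (Fin n) → Herm m h) :
    ∫ p, corr ψ (evalPoly P (coords 0 p)) (evalPoly Q (coords 1 p)) ∂corrGauss ρ n
      = ((∑ S, ρ ^ S.card * corrForm hψ h (P S) (Q S) : ℝ) : ℂ) := by
  rw [← integral_corrForm_evalPoly hψ hρ, ← integral_complex_ofReal]
  exact integral_congr_ae (.of_forall fun p => corr_eq_re hψ _ _)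

/-- The inner product of the two equal unit vectors is 1, so the second moment has no bias. -/
theorem integral_pairAvg_unitDiag (hk : 0 < k) (P : Finset (Fin n) → Herm m h) :
    ∫ M, pairAvg (unitDiag k) (innerForm m h) P P M ∂gaussMatrix n k = ∑ S, ‖P S‖ ^ 2 := by
  have hμ := isSphericalPair_unitDiag hk
  have h1 : ∀ᵐ w ∂unitDiag k, inner ℝ w.1 w.2 = (1 : ℝ) := by
    have hm : Measurable fun x : EuclideanSpace ℝ (Fin k) => (unitVec x, unitVec x) :=
      measurable_unitVec.prodMk measurable_unitVec
    unfold unitDiag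
    rw [ae_map_iff hm.aemeasurable (measurableSet_eq_fun (by fun_prop) (by fun_prop))]
    filter_upwards [ae_ne_zero_gauss hk] with x hx
    rw [real_inner_self_eq_norm_sq, norm_unitVec hx, one_pow]
  have h2 : ∀ s : ℕ, ∫ w, inner ℝ w.1 w.2 ^ s ∂unitDiag k = 1 := by
    intro s
    have h3 : ∀ᵐ w ∂unitDiag k, inner ℝ w.1 w.2 ^ s = (1 : ℝ) := by
      filter_upwards [h1] with w hw
      rw [hw, one_pow]
    rw [integral_congr_ae h3, integral_const, probReal_univ, one_smul]
  rw [integral_pairAvg P P abs_innerForm_le hμ]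
  simp_rw [h2, innerForm_self, one_mul]

/-- Each level up to `d` has bias at most `9 d / √k`, and `|B(P_S, Q_S)| ≤ (‖P_S‖² + ‖Q_S‖²)/2` sums
to at most 1. -/
theorem abs_integral_pairAvg_unitLaw_sub_le {ψ : Matrix (Fin m × Fin m) (Fin m × Fin m) ℂ}
    (hψ : IsNoisyMES ψ) {ρ : ℝ} (hρ : |ρ| ≤ 1) (hk : 0 < k) {P Q : Finset (Fin n) → Herm m h}
    {d : ℕ} (hP : DegreeLE P d) (hP1 : ∑ S, ‖P S‖ ^ 2 ≤ 1) (hQ1 : ∑ S, ‖Q S‖ ^ 2 ≤ 1) :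
    |∫ M, pairAvg (unitLaw ρ k) (corrForm hψ h) P Q M ∂gaussMatrix n k
      - ∑ S, ρ ^ S.card * corrForm hψ h (P S) (Q S)| ≤ d * (9 / √k) := by
  rw [integral_pairAvg P Q (abs_corrForm_le hψ) (isSphericalPair_unitLaw hρ hk),
    ← Finset.sum_sub_distrib]
  simp_rw [← sub_mul]
  have hterm : ∀ S : Finset (Fin n), |(∫ w, inner ℝ w.1 w.2 ^ S.card ∂unitLaw ρ k - ρ ^ S.card)
      * corrForm hψ h (P S) (Q S)| ≤ d * (9 / √k) * ((‖P S‖ ^ 2 + ‖Q S‖ ^ 2) / 2) := by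
    intro S
    rcases lt_or_ge d S.card with hS | hS
    · simp only [hP S hS, map_zero, FunLike.coe_zero, Pi.zero_apply, mul_zero, abs_zero]
      positivity
    · rw [abs_mul]
      refine mul_le_mul ((abs_integral_inner_pow_sub_le hρ hk _).trans ?_)
        ((abs_corrForm_le hψ _ _).trans ?_) (abs_nonneg _) (by positivity)
      · gcongr
      · linarith [two_mul_le_add_sq ‖P S‖ ‖Q S‖]
  refine (Finset.abs_sum_le_sum_abs _ _).trans ((Finset.sum_le_sum fun S _ => hterm S).trans ?_)
  rw [← Finset.mul_sum, ← Finset.sum_div, Finset.sum_add_distrib]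
  exact mul_le_of_le_one_right (by positivity) (by linarith)

end SecondMoment

/-! ### Choice of dimension and the probability bounds -/

section Concentration

variable {n k m h d : ℕ} {δ : ℝ}

theorem one_sub_le_measureReal {Ω : Type*} [MeasurableSpace Ω] {μ : Measure Ω}
    [IsProbabilityMeasure μ] {A B : Set Ω} {b : ℝ} (hB : μ.real B ≤ b) (h : Aᶜ ⊆ B) :
    1 - b ≤ μ.real A := by
  have h1 : (1 : ℝ) ≤ μ.real A + μ.real Aᶜ := by
    rw [← probReal_univ (μ := μ), ← Set.union_compl_self A]
    exact measureReal_union_le _ _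
  linarith [measureReal_mono (μ := μ) h]

theorem measure_second_moment_le (hk : 0 < k) (hδ : 0 < δ) (hkδ : 10 * d * 9 ^ d ≤ k * δ ^ 3)
    {P Q : Finset (Fin n) → Herm m h} (hP : DegreeLE P d) (hQ : DegreeLE Q d)
    (hP1 : ∑ S, ‖P S‖ ^ 2 ≤ 1) (hQ1 : ∑ S, ‖Q S‖ ^ 2 ≤ 1) :
    1 - 2 * δ ≤ (gaussMatrix n k).real {M |
      (∫ x, nnorm2 (Herm.mat (evalPoly P (proj (Matrix.of M) x))) ^ 2 ∂gauss k) ≤ 1 + δ ∧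
      (∫ y, nnorm2 (Herm.mat (evalPoly Q (proj (Matrix.of M) y))) ^ 2 ∂gauss k) ≤ 1 + δ} := by
  have hk' : (0 : ℝ) < k := by exact_mod_cast hk
  have hdev : ∀ R : Finset (Fin n) → Herm m h, DegreeLE R d → ∑ S, ‖R S‖ ^ 2 ≤ 1 →
      (gaussMatrix n k).real {M | δ ≤ |pairAvg (unitDiag k) (innerForm m h) R R M
        - ∫ M', pairAvg (unitDiag k) (innerForm m h) R R M' ∂gaussMatrix n k|} ≤ δ := by
    intro R hR hR1
    refine (measure_pairAvg_deviation_le R R abs_innerForm_le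
      (isSphericalPair_unitDiag hk) hR hR hR1 hR1 hδ).trans ?_
    rw [div_div, div_le_iff₀ (by positivity)]
    linarith
  refine one_sub_le_measureReal (B := _ ∪ _) ((measureReal_union_le _ _).trans
    ((add_le_add (hdev P hP hP1) (hdev Q hQ hQ1)).trans_eq (two_mul δ).symm)) ?_
  intro M hM
  by_contra hM'
  simp only [Set.mem_union, Set.mem_ofPred_eq, not_or, not_le, integral_pairAvg_unitDiag hk] at hM'
  refine hM ⟨?_, ?_⟩
  · rw [integral_nnorm2_proj_sq]
    linarith [(abs_lt.1 hM'.1).2]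
  · rw [integral_nnorm2_proj_sq]
    linarith [(abs_lt.1 hM'.2).2]

/-- The tolerance is split evenly between fluctuation and bias: `40 = 10 · 4` comes from Chebyshev
at `δ/2`, and `324 = 18²` from `9 d / √k ≤ δ/2`. -/
theorem measure_correlation_le (hk : 0 < k) (hδ : 0 < δ) (hkδ : 40 * d * 9 ^ d ≤ k * δ ^ 3)
    (hkδ' : 324 * (d : ℝ) ^ 2 ≤ k * δ ^ 2) {ψ : Matrix (Fin m × Fin m) (Fin m × Fin m) ℂ}
    (hψ : IsNoisyMES ψ) {ρ : ℝ} (hρ : |ρ| ≤ 1)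
    {P Q : Finset (Fin n) → Herm m h} (hP : DegreeLE P d) (hQ : DegreeLE Q d)
    (hP1 : ∑ S, ‖P S‖ ^ 2 ≤ 1) (hQ1 : ∑ S, ‖Q S‖ ^ 2 ≤ 1) :
    1 - δ ≤ (gaussMatrix n k).real {M |
      ‖(∫ p, corr ψ (evalPoly P (proj (Matrix.of M) (coords 0 p)))
            (evalPoly Q (proj (Matrix.of M) (coords 1 p))) ∂corrGauss ρ k) -
        ∫ p, corr ψ (evalPoly P (coords 0 p)) (evalPoly Q (coords 1 p)) ∂corrGauss ρ n‖ ≤ δ} := by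
  have hk' : (0 : ℝ) < k := by exact_mod_cast hk
  have hs : 0 < √(k : ℝ) := Real.sqrt_pos.2 hk'
  have hdev := measure_pairAvg_deviation_le P Q (abs_corrForm_le hψ)
      (isSphericalPair_unitLaw hρ hk) hP hQ hP1 hQ1 (half_pos hδ)
  have hmean := abs_integral_pairAvg_unitLaw_sub_le hψ hρ hk hP hP1 hQ1
  have h1 : (d : ℝ) * (9 / √k) ≤ δ / 2 := by
    rw [mul_div_assoc', div_le_iff₀ hs]
    have h2 : (18 * (d : ℝ)) ^ 2 ≤ (√k * δ) ^ 2 := by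
      rw [mul_pow √(k : ℝ), Real.sq_sqrt hk'.le]
      linarith
    linarith [le_of_sq_le_sq h2 (by positivity)]
  have h2 : 10 * (d : ℝ) * 9 ^ d / k / (δ / 2) ^ 2 ≤ δ := by
    rw [div_div, div_le_iff₀ (by positivity)]
    linarith
  refine one_sub_le_measureReal (hdev.trans h2) ?_
  intro M hM
  by_contra hM'
  rw [Set.mem_ofPred_eq, not_le] at hM'
  refine hM ?_
  rw [Set.mem_ofPred_eq, integral_corr_proj hψ, integral_corr_evalPoly hψ hρ, ← Complex.ofReal_sub,
    Complex.norm_real, Real.norm_eq_abs]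
  refine (abs_sub_le _
    (∫ M', pairAvg (unitLaw ρ k) (corrForm hψ h) P Q M' ∂gaussMatrix n k) _).trans ?_
  linarith

theorem dimension_bounds (hd : 0 < d) (hδ : 0 < δ) (hδ1 : δ ≤ 1)
    (hk : ((3600 : ℕ) : ℝ) * (d : ℝ) ^ (3600 * d) / δ ^ 6 ≤ k) :
    40 * d * 9 ^ d ≤ k * δ ^ 3 ∧ 324 * (d : ℝ) ^ 2 ≤ k * δ ^ 2 := by
  -- For `d ≥ 2` one has `9 ≤ 2^4 ≤ d^4`; the factor 9 covers `d = 1`, where powers of `d` do not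
  -- grow.
  have h9 : 9 ^ d ≤ 9 * d ^ (4 * d) := by
    obtain rfl | h2 : d = 1 ∨ 2 ≤ d := by omega
    · norm_num
    · calc 9 ^ d ≤ 16 ^ d := Nat.pow_le_pow_left (by norm_num) d
        _ = 2 ^ (4 * d) := by rw [pow_mul]; norm_num
        _ ≤ d ^ (4 * d) := Nat.pow_le_pow_left h2 _
        _ ≤ 9 * d ^ (4 * d) := by omega
  have h1 : 40 * d * 9 ^ d ≤ 3600 * d ^ (3600 * d) := by
    calc 40 * d * 9 ^ d ≤ 40 * d * (9 * d ^ (4 * d)) := Nat.mul_le_mul_left _ h9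
      _ = 360 * d ^ (4 * d + 1) := by ring
      _ ≤ 3600 * d ^ (3600 * d) :=
        Nat.mul_le_mul (by norm_num) (Nat.pow_le_pow_right hd (by omega))
  have h2 : 324 * d ^ 2 ≤ 3600 * d ^ (3600 * d) :=
    Nat.mul_le_mul (by norm_num) (Nat.pow_le_pow_right hd (by omega))
  have h1' : 40 * (d : ℝ) * 9 ^ d ≤ ((3600 : ℕ) : ℝ) * (d : ℝ) ^ (3600 * d) := by exact_mod_cast h1
  have h2' : 324 * (d : ℝ) ^ 2 ≤ ((3600 : ℕ) : ℝ) * (d : ℝ) ^ (3600 * d) := by exact_mod_cast h2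
  rw [div_le_iff₀ (by positivity)] at hk
  constructor
  · refine (h1'.trans hk).trans ?_
    exact mul_le_mul_of_nonneg_left (pow_le_pow_of_le_one hδ.le hδ1 (by norm_num))
      (Nat.cast_nonneg k)
  · refine (h2'.trans hk).trans ?_
    exact mul_le_mul_of_nonneg_left (pow_le_pow_of_le_one hδ.le hδ1 (by norm_num))
      (Nat.cast_nonneg k)

end Concentration

end GaussDimRed

end

/-! ### Assembly -/

open GaussDimRed in
theorem mainTheorem10 :
    ∃ C : ℕ, 0 < C ∧ ∀ (d : ℕ) (δ : ℝ), 0 < d → 0 < δ →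
      ∀ n₀ : ℕ, n₀ = ⌈((C : ℝ) * (d : ℝ) ^ (C * d)) / δ ^ 6⌉₊ →
      ∀ m h n : ℕ, 2 ≤ m → 0 < h → 0 < n →
      ∃ f g : Matrix (Fin n) (Fin n₀) ℝ → L2Herm m h n → L2Herm m h n₀,
        (∀ M : Matrix (Fin n) (Fin n₀) ℝ, M ≠ 0 →
          IsLinearMap ℝ (f M) ∧ IsLinearMap ℝ (g M) ∧
          f M (idL2 m h n) = idL2 m h n₀ ∧ g M (idL2 m h n) = idL2 m h n₀) ∧
        (∀ (M : Matrix (Fin n) (Fin n₀) ℝ) (P : Finset (Fin n) → Herm m h), DegreeLE P d →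
          (f M (toL2 P) =ᵐ[gauss n₀] fun x => evalPoly P (proj M x)) ∧
          (g M (toL2 P) =ᵐ[gauss n₀] fun y => evalPoly P (proj M y))) ∧
        ∀ ψ : Matrix (Fin m × Fin m) (Fin m × Fin m) ℂ, IsNoisyMES ψ →
        ∀ P Q : Finset (Fin n) → Herm m h, DegreeLE P d → DegreeLE Q d →
          (∫ z, nnorm2 (Herm.mat (evalPoly P z)) ^ 2 ∂gauss n) ≤ 1 →
          (∫ z, nnorm2 (Herm.mat (evalPoly Q z)) ^ 2 ∂gauss n) ≤ 1 →
          1 - 2 * δ ≤ (gaussMatrix n n₀).real {M |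
            (∫ x, nnorm2 (Herm.mat (evalPoly P (proj (Matrix.of M) x))) ^ 2
              ∂gauss n₀) ≤ 1 + δ ∧
            (∫ y, nnorm2 (Herm.mat (evalPoly Q (proj (Matrix.of M) y))) ^ 2
              ∂gauss n₀) ≤ 1 + δ} ∧
          1 - δ ≤ (gaussMatrix n n₀).real {M |
            ‖(∫ p, corr ψ (evalPoly P (proj (Matrix.of M) (coords 0 p)))
                  (evalPoly Q (proj (Matrix.of M) (coords 1 p)))
                ∂corrGauss (maximalCorrelation ψ) n₀) -
              ∫ p, corr ψ (evalPoly P (coords 0 p)) (evalPoly Q (coords 1 p))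
                ∂corrGauss (maximalCorrelation ψ) n‖ ≤ δ} ∧
          (∫ z, traceZeta (evalPoly P z) ∂gauss n) =
            (∫ w, traceZeta (evalPoly P (proj (Matrix.of w.1) w.2))
              ∂(gaussMatrix n n₀).prod (gauss n₀)) ∧
          (∫ z, traceZeta (evalPoly Q z) ∂gauss n) =
            (∫ w, traceZeta (evalPoly Q (proj (Matrix.of w.1) w.2))
              ∂(gaussMatrix n n₀).prod (gauss n₀)) := by
  -- The constant only has to dominate `360 d^(4d+1)` and `324 d²`, with ample room.
  refine ⟨3600, by norm_num, ?_⟩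
  intro d δ hd hδ n₀ hn₀ m h n hm hh hn
  have hd' : (0 : ℝ) < d := by exact_mod_cast hd
  have hpos : 0 < ((3600 : ℕ) : ℝ) * (d : ℝ) ^ (3600 * d) / δ ^ 6 := by positivity
  have hk : 0 < n₀ := by
    rw [hn₀]
    exact Nat.ceil_pos.2 hpos
  have hle : ((3600 : ℕ) : ℝ) * (d : ℝ) ^ (3600 * d) / δ ^ 6 ≤ n₀ := by
    rw [hn₀]
    exact Nat.le_ceil _
  refine ⟨reduce, reduce, fun M _ => ⟨isLinearMap_reduce M, isLinearMap_reduce M, reduce_id M,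
    reduce_id M⟩, fun M P _ => ⟨reduce_toL2 M P, reduce_toL2 M P⟩, ?_⟩
  intro ψ hψ P Q hP hQ hP1 hQ1
  simp_rw [← Herm.norm_eq_nnorm2, integral_norm_evalPoly_sq] at hP1 hQ1
  have hρ : |maximalCorrelation ψ| ≤ 1 := by
    rw [abs_of_nonneg (maximalCorrelation_nonneg ψ)]
    exact hψ.maximalCorrelation_lt_one.le
  refine ⟨?_, ?_, integral_traceZeta_proj hk P, integral_traceZeta_proj hk Q⟩
  -- For `δ ≥ 1` the required probability is not positive; for `δ ≤ 1` the power `δ^6` is below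
  -- those needed.
  · rcases le_total δ 1 with h1 | h1
    · have hb := (dimension_bounds hd hδ h1 hle).1
      have h0 : (0 : ℝ) ≤ d * 9 ^ d := by positivity
      exact measure_second_moment_le hk hδ (by linarith) hP hQ hP1 hQ1
    · exact le_trans (by linarith) measureReal_nonneg
  · rcases le_total δ 1 with h1 | h1
    · have hb := dimension_bounds hd hδ h1 hle
      exact measure_correlation_le hk hδ hb.1 hb.2 hψ hρ hP hQ hP1 hQ1
    · exact le_trans (by linarith) measureReal_nonneg
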